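/- **Theorem 3.2.** For each $m\ge 1$ let $p=p_m\in(0,1)$ and $\psi=\psi_m>0$, and let $(\nu_1,X_1),\dots,(\nu_m,X_m)$ be i.i.d. with $\nu_i\sim\mathrm{Bernoulli}(p)$, $X_i\mid\nu_i=0\sim N(0,1)$ and $X_i\mid\nu_i=1\sim N(0,1+\psi^2)$, so that $X_i\sim(1-p)N(0,1)+pN(0,1+\psi^2)$. One tests $H_{0i}:\nu_i=0$ against $H_{1i}:\nu_i=1$ for $i=1,\dots,m$. The Bayes risk of a multiple testing rule is $R=\sum_{i=1}^m\{(1-p)t_{1i}+p\,t_{2i}\}$, where $t_{1i}=\Pr(H_{0i}\text{ is rejected}\mid\nu_i=0)$ and $t_{2i}=\Pr(H_{0i}\text{ is not rejected}\mid\nu_i=1)$. The Bayes Oracle rejects $H_{0i}$ if and only if $f(X_i\mid\nu_i=1)/f(X_i\mid\nu_i=0)>(1-p)/p$, with $f(\cdot\mid\nu_i)$ the conditional density of $X_i$; its Bayes risk is denoted $R^{BO}_{Opt}$. Assume that, as $m\to\infty$, $p\to0$, $u=\psi^2\to\infty$, $v=u\big(\tfrac{1-p}{p}\big)^2\to\infty$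 and $\log v/u\to C\in(0,\infty)$, and that $p\propto m^{-\epsilon}$ for some $0<\epsilon<1$, i.e. for some constant $c>0$, $p_m=c\,m^{-\epsilon}$ for all sufficiently large $m$. Consider the one-group prior $\mu_i\mid(\lambda_i^2,\tau^2)\sim N(0,\lambda_i^2\tau^2)$, where $\lambda_i^2$ has the proper density $\pi(t)=Kt^{-a-1}L(t)$ on $(0,\infty)$; here $K>0$ and $L$ is a positive measurable function on $(0,\infty)$ which is slowly varying: $L(\alpha t)/L(t)\to1$ as $t\to\infty$ for every $\alpha>0$. Assume that either (I) $\tfrac12<a<1$, or (II) $a=\tfrac12$ and $L(t)/\sqrt{\log t}\to0$ as $t\to\infty$. Let $\kappa_i=1/(1+\lambda_i^2\tau^2)$, and let $E(\kappa_i\mid X_i,\tau)$ be its posterior mean under this prior and the likelihood $X_i\mid\mu_i\sim N(\mu_i,1)$. Fix constants $c_1\ge2$ and $c_2\ge1$, and put $$\widehat\tau=\max\Big\{\frac1m,\ \frac1{c_2m}\sum_{j=1}^m1\{|X_j|>\sqrt{c_1\log m}\}\Big\}.$$ The empirical Bayes rule rejects $H_{0i}$ if and only if $1-E(\kappa_i\mid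 X_i,\widehat\tau)>\tfrac12$, where $E(\kappa_i\mid X_i,\widehat\tau)$ is $E(\kappa_i\mid X_i,\tau)$ evaluated at $\tau=\widehat\tau$. Let $R^{EB}_{OG}$ be its Bayes risk, and let $\Phi$ be the standard normal distribution function. Then, for every fixed $\eta\in(0,\tfrac12)$ and $\delta\in(0,1)$, $$R^{EB}_{OG}\le mp\Big[2\Phi\Big(\sqrt{\frac{2aC}{\eta(1-\delta)}}\Big)-1\Big](1+o(1))\qquad\text{as }m\to\infty,$$ where the $o(1)$ term may depend on $\eta$ and $\delta$. Consequently the rule is optimal up to a constant factor: $R^{EB}_{OG}=O(R^{BO}_{Opt})$ as $m\to\infty$. -/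

import Mathlib

open MeasureTheory ProbabilityTheory Filter Topology Set

noncomputable section

namespace MultTest

/-! ### The two-groups model, multiple testing rules and the Bayes risk -/

/-- Joint law of one pair `(νᵢ, Xᵢ)` in the two-groups model with `σ² = 1`: `νᵢ ∼ Bernoulli(p)`
(`false` is `νᵢ = 0`, `true` is `νᵢ = 1`), `Xᵢ ∼ N(0, 1)` given `νᵢ = 0`, and
`Xᵢ ∼ N(0, 1 + ψ²)` given `νᵢ = 1`. The marginal law of `Xᵢ` is
`(1 - p) N(0, 1) + p N(0, 1 + ψ²)`. -/
def twoGroupsPair (p ψ : ℝ) : Measure (Bool × ℝ) :=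
  ENNReal.ofReal (1 - p) • (Measure.dirac false).prod (gaussianReal 0 1) +
    ENNReal.ofReal p • (Measure.dirac true).prod (gaussianReal 0 (Real.toNNReal (1 + ψ ^ 2)))

/-- Joint law of `(ν₁, X₁), …, (νₘ, Xₘ)`, independent with common law `twoGroupsPair p ψ`. -/
def twoGroups (m : ℕ) (p ψ : ℝ) : Measure (Fin m → Bool × ℝ) :=
  Measure.pi fun _ => twoGroupsPair p ψ

/-- The observed data `(X₁, …, Xₘ)`. -/
def obs {m : ℕ} (ω : Fin m → Bool × ℝ) : Fin m → ℝ := fun j => (ω j).2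

/-- A (non-randomized) multiple testing rule for `m` hypotheses: `d i` is the set of data vectors
`(x₁, …, xₘ)` for which `H₀ᵢ : νᵢ = 0` is rejected. -/
abbrev Rule (m : ℕ) := Fin m → Set (Fin m → ℝ)

/-- Probability of type I error of the `i`-th test: `Pr(reject H₀ᵢ ∣ νᵢ = 0)`. -/
def typeI {m : ℕ} (p ψ : ℝ) (d : Rule m) (i : Fin m) : ℝ :=
  ((twoGroups m p ψ)[|{ω | (ω i).1 = false}]).real {ω | obs ω ∈ d i}

/-- Probability of type II error of the `i`-th test: `Pr(do not reject H₀ᵢ ∣ νᵢ = 1)`. -/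
def typeII {m : ℕ} (p ψ : ℝ) (d : Rule m) (i : Fin m) : ℝ :=
  ((twoGroups m p ψ)[|{ω | (ω i).1 = true}]).real {ω | obs ω ∉ d i}

/-- Bayes risk of a multiple testing rule for the additive symmetric 0-1 loss:
`R = ∑ᵢ ((1 - p) t₁ᵢ + p t₂ᵢ)`. -/
def bayesRisk {m : ℕ} (p ψ : ℝ) (d : Rule m) : ℝ :=
  ∑ i, ((1 - p) * typeI p ψ d i + p * typeII p ψ d i)

/-- The Bayes Oracle: reject `H₀ᵢ` iff `f(xᵢ ∣ νᵢ = 1) / f(xᵢ ∣ νᵢ = 0) > (1 - p) / p`, where the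
densities are those of `N(0, 1 + ψ²)` and `N(0, 1)`. -/
def bayesOracle (m : ℕ) (p ψ : ℝ) : Rule m := fun i =>
  {x | (1 - p) / p <
    gaussianPDFReal 0 (Real.toNNReal (1 + ψ ^ 2)) (x i) / gaussianPDFReal 0 1 (x i)}

/-- The asymptotic framework: `p → 0`, `u = ψ² → ∞`, `v = u ((1 - p) / p)² → ∞`, and
`log v / u → C ∈ (0, ∞)`. -/
structure AsympScheme (ψ p : ℕ → ℝ) (C : ℝ) : Prop where
  p_tendsto : Tendsto p atTop (𝓝 0)
  u_tendsto : Tendsto (fun m => ψ m ^ 2) atTop atTop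
  v_tendsto : Tendsto (fun m => ψ m ^ 2 * ((1 - p m) / p m) ^ 2) atTop atTop
  C_pos : 0 < C
  ratio_tendsto :
    Tendsto (fun m => Real.log (ψ m ^ 2 * ((1 - p m) / p m) ^ 2) / ψ m ^ 2) atTop (𝓝 C)

/-! ### The one-group priors -/

/-- `L` is slowly varying (in Karamata's sense) over `(A, ∞)`: measurable and positive there, and
`L(α x) / L(x) → 1` as `x → ∞` for every `α > 0`. -/
structure SlowlyVaryingOn (A : ℝ) (L : ℝ → ℝ) : Prop where
  measurable : Measurable ((Ioi A).domRestrict L)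
  pos : ∀ t ∈ Ioi A, 0 < L t
  tendsto : ∀ α : ℝ, 0 < α → Tendsto (fun x => L (α * x) / L x) atTop (𝓝 1)

/-- The density `π(t) = K t ^ (-a - 1) L(t)`, `t > 0`, of the local parameter `t = λ²`. -/
def localPrior (a K : ℝ) (L : ℝ → ℝ) (t : ℝ) : ℝ := K * t ^ (-a - 1) * L t

/-- `π(t) = K t ^ (-a - 1) L(t)` is a proper prior on `(0, ∞)` with `K > 0` and `L` slowly varying
over `(0, ∞)`. (Properness forces `L` to be non-constant.) -/
structure IsLocalPrior (a K : ℝ) (L : ℝ → ℝ) : Prop where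
  slowlyVarying : SlowlyVaryingOn 0 L
  K_pos : 0 < K
  integrableOn : IntegrableOn (localPrior a K L) (Ioi 0)
  integral_eq_one : ∫ t in Ioi 0, localPrior a K L t = 1

/-- The shrinkage coefficient `κ = 1 / (1 + λ² τ²)` as a function of `t = λ²`. -/
def shrinkCoeff (τ t : ℝ) : ℝ := 1 / (1 + t * τ ^ 2)

/-- The likelihood of `t = λ²` at the observation `x`, for the hierarchy `X ∣ μ ∼ N(μ, 1)` and
`μ ∣ (λ², τ²) ∼ N(0, λ² τ²)`. -/
def likelihood (τ x t : ℝ) : ℝ :=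
  ∫ μ, gaussianPDFReal μ 1 x ∂(gaussianReal 0 (Real.toNNReal (t * τ ^ 2)))

/-- The posterior mean `E(κ ∣ X = x, τ)` under the prior `localPrior a K L` on `λ²`
(Bayes' formula). -/
def postMeanShrink (a K : ℝ) (L : ℝ → ℝ) (x τ : ℝ) : ℝ :=
  (∫ t in Ioi 0, shrinkCoeff τ t * likelihood τ x t * localPrior a K L t) /
    ∫ t in Ioi 0, likelihood τ x t * localPrior a K L t

/-! ### The empirical Bayes rule -/

/-- The estimate
`τ̂ = max {1 / m, (c₂ m)⁻¹ ∑ⱼ 1{|xⱼ| > √(c₁ log m)}}`. -/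
def tauHat (c₁ c₂ : ℝ) {m : ℕ} (x : Fin m → ℝ) : ℝ :=
  max (1 / (m : ℝ)) (1 / (c₂ * m) *
    ∑ j, if √(c₁ * Real.log m) < |x j| then (1 : ℝ) else 0)

/-- The empirical Bayes rule: reject `H₀ᵢ` iff `1 - E(κᵢ ∣ Xᵢ, τ̂) > 1 / 2`. -/
def ebRule (a K : ℝ) (L : ℝ → ℝ) (c₁ c₂ : ℝ) (m : ℕ) : Rule m := fun i =>
  {x | 1 / 2 < 1 - postMeanShrink a K L (x i) (tauHat c₁ c₂ x)}

/-- The standard normal distribution function `Φ`. -/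
def stdNormalCDF (x : ℝ) : ℝ := cdf (gaussianReal 0 1) x

end MultTest

end

/-! The risk of a rule is the sum over the tests of the probability that a true null is rejected or
a false null is accepted, so only the acceptance region of one observation matters once `τ̂` is under
control. The number of exceedances of `√(c₁ log m)` is binomial with mean of exact order `m p`, and
`m p → ∞` polynomially, so Chernoff bounds give `b p ≤ τ̂ ≤ 5 p` outside an event of probability
`o(p)` (`AsympScheme.exists_tauHat_bounds`). On the good event the posterior is studied uniformly in
`τ ∈ [b p, 5 p]`, which takes care of the dependence between `τ̂` and the observation; monotonicity
of the posterior mean in `τ` is never needed.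

* Type I. Rejection forces `exp(-x² / 2) = O(J(τ))`, where `J(τ)` is the prior mean of `(1 - κ)√κ`.
  For `a > 1/2`, `J(τ) = o(τ)` because the prior has moments of order greater than `1/2`; for
  `a = 1/2` and `L = o(√log)`, `J(τ) = o(τ √(log(1/τ)))`, and the factor `1/x` in Mills' bound
  cancels the logarithm. Hence the type I error probability is `o(p)`
  (`IsLocalPrior.eventually_null_rejection`).
* Type II. For every `Q > 8a` and all small `τ`, `x² ≥ Q log(1/τ)` implies rejection
  (`IsLocalPrior.eventually_reject`). As `2 log(1/p) / ψ² → C` and `x = √(1 + ψ²) z` with `z`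
  standard normal under the alternative, the type II error probability is at most
  `P(z² ≤ r) + o(1)` for each `r > 4aC`. Since `η (1 - δ) < 1/2`, the constant
  `r = 2aC / (η (1 - δ))` qualifies.

The slowly varying factor enters only through the ratio of the density at `2t` and at `t`: iterating
it over dyadic intervals yields the moments and the lower bounds on the mass of the prior that are
used, without Karamata's uniform convergence theorem. For the Bayes Oracle, the observations with
`z² ≤ C/2` are eventually accepted, so its risk is at least a constant times `m p`. -/

namespace MultTest

/-! ### Mass and moments of the local prior -/

section LocalPrior

variable {a b K : ℝ} {L : ℝ → ℝ}

lemma IsLocalPrior.pos (h : IsLocalPrior a K L) {t : ℝ} (ht : 0 < t) : 0 < localPrior a K L t :=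
  mul_pos (mul_pos h.K_pos (Real.rpow_pos_of_pos ht _)) (h.slowlyVarying.pos t ht)

lemma localPrior_two_mul {t : ℝ} (ht : 0 < t) (hL : L t ≠ 0) :
    2 * localPrior a K L (2 * t) = 2 ^ (-a) * (L (2 * t) / L t) * localPrior a K L t := by
  have h2 : (2 : ℝ) * 2 ^ (-a - 1) = 2 ^ (-a) := by
    rw [Real.rpow_sub_one two_ne_zero]; ring
  rw [localPrior, localPrior, Real.mul_rpow zero_le_two ht.le, ← h2]
  field_simp

/-- Up to an arbitrarily small loss in the exponent, doubling the argument divides `t π(t)` by at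
least `2 ^ a`. -/
lemma IsLocalPrior.eventually_two_mul_le (h : IsLocalPrior a K L) (hb : b < a) :
    ∀ᶠ t in atTop, 2 * localPrior a K L (2 * t) ≤ 2 ^ (-b) * localPrior a K L t := by
  have h1 : (1 : ℝ) < 2 ^ (a - b) := Real.one_lt_rpow one_lt_two (by linarith)
  filter_upwards [(h.slowlyVarying.tendsto 2 two_pos).eventually_lt_const h1,
    eventually_gt_atTop 0] with t ht ht0
  rw [localPrior_two_mul ht0 (h.slowlyVarying.pos t ht0).ne']
  refine mul_le_mul_of_nonneg_right ?_ (h.pos ht0).le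
  calc (2 : ℝ) ^ (-a) * (L (2 * t) / L t) ≤ 2 ^ (-a) * 2 ^ (a - b) := by gcongr
    _ = 2 ^ (-b) := by rw [← Real.rpow_add two_pos]; ring_nf

/-- Up to an arbitrarily small loss in the exponent, doubling the argument divides `t π(t)` by at
most `2 ^ a`. -/
lemma IsLocalPrior.eventually_le_two_mul (h : IsLocalPrior a K L) (hb : a < b) :
    ∀ᶠ t in atTop, 2 ^ (-b) * localPrior a K L t ≤ 2 * localPrior a K L (2 * t) := by
  have h1 : (2 : ℝ) ^ (a - b) < 1 := Real.rpow_lt_one_of_one_lt_of_neg one_lt_two (by linarith)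
  filter_upwards [(h.slowlyVarying.tendsto 2 two_pos).eventually_const_lt h1,
    eventually_gt_atTop 0] with t ht ht0
  rw [localPrior_two_mul ht0 (h.slowlyVarying.pos t ht0).ne']
  refine mul_le_mul_of_nonneg_right ?_ (h.pos ht0).le
  calc (2 : ℝ) ^ (-b) = 2 ^ (-a) * 2 ^ (a - b) := by rw [← Real.rpow_add two_pos]; ring_nf
    _ ≤ 2 ^ (-a) * (L (2 * t) / L t) := by gcongr

/-- If `2 g(2t) ≤ ρ g(t)` with `ρ < 1` then `I(M) = ∫ t in T..M, g t` satisfies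
`I(M) ≤ I(2T) + ρ I(M)`, so the truncated integrals of `g` are bounded. -/
lemma integrableOn_Ioi_of_two_mul_le {g : ℝ → ℝ} {T ρ : ℝ} (hT : 0 < T) (hρ : ρ < 1)
    (hg0 : ∀ t, T ≤ t → 0 ≤ g t) (hgi : ∀ x y, T ≤ x → T ≤ y → IntervalIntegrable g volume x y)
    (hg : ∀ t, T ≤ t → 2 * g (2 * t) ≤ ρ * g t) : IntegrableOn g (Ioi T) := by
  have key : ∀ M, T ≤ M → ∫ t in T..M, g t ≤ (∫ t in T..2 * T, g t) / (1 - ρ) := by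
    intro M hM
    have hscale : ∫ t in 2 * T..2 * M, g t = ∫ t in T..M, 2 * g (2 * t) := by
      rw [intervalIntegral.integral_const_mul,
        intervalIntegral.integral_comp_mul_left _ two_ne_zero]
      simp
    have hi2 : IntervalIntegrable (fun t => 2 * g (2 * t)) volume T M := by
      have := (hgi (2 * T) (2 * M) (by linarith) (by linarith)).comp_mul_left (c := 2)
      simpa using this.const_mul 2
    have hle : ∫ t in T..M, 2 * g (2 * t) ≤ ρ * ∫ t in T..M, g t := by
      rw [← intervalIntegral.integral_const_mul]
      exact intervalIntegral.integral_mono_on hM hi2 ((hgi T M le_rfl hM).const_mul ρ)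
        fun t ht => hg t ht.1
    have hadd : (∫ t in T..2 * T, g t) + ∫ t in 2 * T..2 * M, g t = ∫ t in T..2 * M, g t :=
      intervalIntegral.integral_add_adjacent_intervals (hgi _ _ le_rfl (by linarith))
        (hgi _ _ (by linarith) (by linarith))
    have hadd' : (∫ t in T..M, g t) + ∫ t in M..2 * M, g t = ∫ t in T..2 * M, g t :=
      intervalIntegral.integral_add_adjacent_intervals (hgi _ _ le_rfl hM)
        (hgi _ _ hM (by linarith))
    have hnn : 0 ≤ ∫ t in M..2 * M, g t :=
      intervalIntegral.integral_nonneg (by linarith) fun t ht => hg0 t (hM.trans ht.1)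
    rw [le_div_iff₀ (by linarith)]
    linarith
  refine integrableOn_Ioi_of_intervalIntegral_norm_bounded
    ((∫ t in T..2 * T, g t) / (1 - ρ)) T (l := atTop) (b := fun x => x) (fun M => ?_) tendsto_id ?_
  · rcases le_total T M with hM | hM
    · exact (intervalIntegrable_iff_integrableOn_Ioc_of_le hM).1 (hgi T M le_rfl hM)
    · simp [Ioc_eq_empty (not_lt.2 hM)]
  · filter_upwards [eventually_ge_atTop T] with M hM
    refine le_trans (le_of_eq ?_) (key M hM)
    refine intervalIntegral.integral_congr fun t ht => ?_
    rw [uIcc_of_le hM] at ht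
    exact Real.norm_of_nonneg (hg0 t ht.1)

lemma IsLocalPrior.intervalIntegrable (h : IsLocalPrior a K L) {x y : ℝ} (hx : 0 ≤ x)
    (hy : 0 ≤ y) : IntervalIntegrable (localPrior a K L) volume x y := by
  rw [intervalIntegrable_iff]
  exact h.integrableOn.mono_set fun t ht => (le_min hx hy).trans_lt ht.1

/-- The local prior has finite moments of every order `b < a`. -/
lemma IsLocalPrior.integrableOn_rpow_mul (h : IsLocalPrior a K L) (hb0 : 0 ≤ b) (hb : b < a) :
    IntegrableOn (fun t => t ^ b * localPrior a K L t) (Ioi 0) := by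
  have hcont : Continuous fun t : ℝ => t ^ b := Real.continuous_rpow_const hb0
  obtain ⟨T, hT0, hT⟩ : ∃ T, 0 < T ∧ ∀ t, T ≤ t → 2 * localPrior a K L (2 * t) ≤
      2 ^ (-((a + b) / 2)) * localPrior a K L t := by
    obtain ⟨T, hT⟩ := eventually_atTop.1 (h.eventually_two_mul_le (b := (a + b) / 2) (by linarith))
    exact ⟨max T 1, by positivity, fun t ht => hT t ((le_max_left _ _).trans ht)⟩
  have htail : IntegrableOn (fun t => t ^ b * localPrior a K L t) (Ioi T) := by
    refine integrableOn_Ioi_of_two_mul_le (ρ := 2 ^ (-((a - b) / 2))) hT0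
      (Real.rpow_lt_one_of_one_lt_of_neg one_lt_two (by linarith)) (fun t ht => ?_)
      (fun x y hx hy => ?_) (fun t ht => ?_)
    · exact mul_nonneg (Real.rpow_nonneg (hT0.le.trans ht) _) (h.pos (hT0.trans_le ht)).le
    · exact (h.intervalIntegrable (hT0.le.trans hx) (hT0.le.trans hy)).continuousOn_mul
        hcont.continuousOn
    · have ht0 : 0 < t := hT0.trans_le ht
      have h2 : (2 : ℝ) ^ b * 2 ^ (-((a + b) / 2)) = 2 ^ (-((a - b) / 2)) := by
        rw [← Real.rpow_add two_pos]; ring_nf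
      calc 2 * ((2 * t) ^ b * localPrior a K L (2 * t))
          = 2 ^ b * t ^ b * (2 * localPrior a K L (2 * t)) := by
            rw [Real.mul_rpow zero_le_two ht0.le]; ring
        _ ≤ 2 ^ b * t ^ b * (2 ^ (-((a + b) / 2)) * localPrior a K L t) := by
            exact mul_le_mul_of_nonneg_left (hT t ht) (by positivity)
        _ = _ := by rw [← h2]; ring
  rw [← Ioc_union_Ioi_eq_Ioi hT0.le]
  refine IntegrableOn.union ?_ htail
  exact (intervalIntegrable_iff_integrableOn_Ioc_of_le hT0.le).1
    ((h.intervalIntegrable le_rfl hT0.le).continuousOn_mul hcont.continuousOn)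

/-- The prior mass of `(X, 4X]` is not smaller than a constant times `X ^ (-b)`, for any `b > a`
with `b > 0`: the mass of a dyadic interval decays at most by the factor `2 ^ (-b)` at each
doubling, and `(X, 4X]` contains a dyadic interval. -/
lemma IsLocalPrior.exists_rpow_le_integral (h : IsLocalPrior a K L) (hb0 : 0 < b) (hb : a < b) :
    ∃ c, 0 < c ∧ ∀ᶠ X : ℝ in atTop, c * X ^ (-b) ≤ ∫ t in X..4 * X, localPrior a K L t := by
  obtain ⟨T, hT0, hT⟩ : ∃ T, 0 < T ∧ ∀ t, T ≤ t → 2 ^ (-b) * localPrior a K L t ≤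
      2 * localPrior a K L (2 * t) := by
    obtain ⟨T, hT⟩ := eventually_atTop.1 (h.eventually_le_two_mul hb)
    exact ⟨max T 1, by positivity, fun t ht => hT t ((le_max_left _ _).trans ht)⟩
  set G : ℝ → ℝ := fun S => ∫ t in S..2 * S, localPrior a K L t with hG
  have hstep : ∀ S, T ≤ S → 2 ^ (-b) * G S ≤ G (2 * S) := by
    intro S hS
    have hS0 : 0 < S := hT0.trans_le hS
    have hscale : G (2 * S) = ∫ t in S..2 * S, 2 * localPrior a K L (2 * t) := by
      rw [intervalIntegral.integral_const_mul,
        intervalIntegral.integral_comp_mul_left _ two_ne_zero]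
      simp [hG]
    have hi2 : IntervalIntegrable (fun t => 2 * localPrior a K L (2 * t)) volume S (2 * S) := by
      have := (h.intervalIntegrable (x := 2 * S) (y := 2 * (2 * S)) (by linarith)
        (by linarith)).comp_mul_left (c := 2)
      simpa using this.const_mul 2
    rw [hscale, hG, ← intervalIntegral.integral_const_mul]
    exact intervalIntegral.integral_mono_on (by linarith)
      ((h.intervalIntegrable hS0.le (by linarith)).const_mul _) hi2
      fun t ht => hT t (hS.trans ht.1)
  have hpow : ∀ n : ℕ, ((2 : ℝ) ^ n) ^ (-b) * G T ≤ G (2 ^ n * T) := by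
    intro n
    induction n with
    | zero => simp
    | succ n ih =>
      have h1 : (1 : ℝ) ≤ 2 ^ n := one_le_pow₀ one_le_two
      have e : (2 : ℝ) ^ (n + 1) * T = 2 * (2 ^ n * T) := by ring
      rw [e]
      refine le_trans ?_ (hstep _ (by nlinarith))
      calc ((2 : ℝ) ^ (n + 1)) ^ (-b) * G T = 2 ^ (-b) * (((2 : ℝ) ^ n) ^ (-b) * G T) := by
            rw [pow_succ', Real.mul_rpow zero_le_two (by positivity)]; ring
        _ ≤ _ := by gcongr
  have hGT : 0 < G T := intervalIntegral.intervalIntegral_pos_of_pos_on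
    (h.intervalIntegrable hT0.le (by linarith)) (fun t ht => h.pos (hT0.trans ht.1)) (by linarith)
  refine ⟨G T * (2 / T) ^ (-b), by positivity, ?_⟩
  filter_upwards [eventually_ge_atTop T] with X hX
  have hX0 : 0 < X := hT0.trans_le hX
  obtain ⟨n, hn1, hn2⟩ := exists_nat_pow_near ((one_le_div₀ hT0).2 hX) one_lt_two
  rw [le_div_iff₀ hT0] at hn1
  rw [div_lt_iff₀ hT0] at hn2
  have hn3 : (2 : ℝ) ^ (n + 1) * T ≤ 2 * X := by rw [pow_succ']; linarith
  have hn4 : (2 : ℝ) ^ (n + 1) ≤ 2 / T * X := by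
    rw [div_mul_eq_mul_div, le_div_iff₀ hT0]; exact hn3
  calc G T * (2 / T) ^ (-b) * X ^ (-b) = (2 / T * X) ^ (-b) * G T := by
        rw [Real.mul_rpow (by positivity) hX0.le]; ring
    _ ≤ ((2 : ℝ) ^ (n + 1)) ^ (-b) * G T := by
        refine mul_le_mul_of_nonneg_right ?_ hGT.le
        exact Real.rpow_le_rpow_of_nonpos (by positivity) hn4 (by linarith)
    _ ≤ G (2 ^ (n + 1) * T) := hpow _
    _ ≤ ∫ t in X..4 * X, localPrior a K L t := by
        refine intervalIntegral.integral_mono_interval hn2.le (by linarith) (by linarith) ?_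
          (h.intervalIntegrable hX0.le (by linarith))
        exact (ae_restrict_iff' measurableSet_Ioc).2
          (.of_forall fun t ht => (h.pos (hX0.trans ht.1)).le)

end LocalPrior

/-! ### The posterior mean of the shrinkage coefficient -/

/-- The marginal likelihood `√κ exp(-κ x² / 2)` of `t = λ²`, without the factor `(2π) ^ (-1/2)`. -/
noncomputable def shrinkKernel (τ x t : ℝ) : ℝ :=
  √(shrinkCoeff τ t) * Real.exp (-(shrinkCoeff τ t * x ^ 2 / 2))

/-- An upper bound for the unnormalized posterior mean of `1 - κ`, uniform in the observation. -/
noncomputable def signalMass (a K : ℝ) (L : ℝ → ℝ) (τ : ℝ) : ℝ :=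
  ∫ t in Ioi 0, (1 - shrinkCoeff τ t) * √(shrinkCoeff τ t) * localPrior a K L t

section Posterior

variable {a b K : ℝ} {L : ℝ → ℝ}

lemma shrinkCoeff_pos {τ t : ℝ} (ht : 0 ≤ t) : 0 < shrinkCoeff τ t := by
  unfold shrinkCoeff; positivity

lemma shrinkCoeff_le_one {τ t : ℝ} (ht : 0 ≤ t) : shrinkCoeff τ t ≤ 1 := by
  unfold shrinkCoeff
  rw [div_le_one (by positivity)]
  nlinarith [mul_nonneg ht (sq_nonneg τ)]

lemma measurable_shrinkCoeff (τ : ℝ) : Measurable (shrinkCoeff τ) := by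
  unfold shrinkCoeff; fun_prop

lemma measurable_shrinkKernel (τ x : ℝ) : Measurable (shrinkKernel τ x) := by
  have := measurable_shrinkCoeff τ
  unfold shrinkKernel; fun_prop

lemma shrinkKernel_pos {τ x t : ℝ} (ht : 0 ≤ t) : 0 < shrinkKernel τ x t :=
  mul_pos (Real.sqrt_pos.2 (shrinkCoeff_pos ht)) (Real.exp_pos _)

lemma shrinkKernel_le_exp {τ x t : ℝ} (ht : 0 ≤ t) :
    shrinkKernel τ x t ≤ Real.exp (-(shrinkCoeff τ t * x ^ 2 / 2)) :=
  mul_le_of_le_one_left (Real.exp_pos _).le (Real.sqrt_le_one.2 (shrinkCoeff_le_one ht))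

lemma shrinkKernel_le_one {τ x t : ℝ} (ht : 0 ≤ t) : shrinkKernel τ x t ≤ 1 := by
  refine (shrinkKernel_le_exp ht).trans (Real.exp_le_one_iff.2 ?_)
  have := mul_nonneg (shrinkCoeff_pos (τ := τ) ht).le (sq_nonneg x)
  linarith

/-- Completing the square in the normal-normal mixture. -/
lemma likelihood_eq {τ x t : ℝ} (hτ : 0 < τ) (ht : 0 < t) :
    likelihood τ x t = (√(2 * Real.pi))⁻¹ * shrinkKernel τ x t := by
  have hv : 0 < t * τ ^ 2 := by positivity
  obtain ⟨v, hvd⟩ : ∃ v, v = t * τ ^ 2 := ⟨_, rfl⟩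
  have hκ : shrinkCoeff τ t = 1 / (1 + v) := by rw [hvd, shrinkCoeff]
  rw [likelihood, shrinkKernel, hκ, ← hvd]
  rw [← hvd] at hv
  have hv1 : 0 < v / (1 + v) := by positivity
  rw [integral_gaussianReal_eq_integral_smul (by simpa using hv)]
  have key : ∀ μ : ℝ, gaussianPDFReal 0 (Real.toNNReal v) μ • gaussianPDFReal μ 1 x =
      ((√(2 * Real.pi))⁻¹ * (√(1 / (1 + v)) * Real.exp (-(1 / (1 + v) * x ^ 2 / 2)))) *
        gaussianPDFReal (x * v / (1 + v)) (Real.toNNReal (v / (1 + v))) μ := by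
    intro μ
    have hs : √(2 * Real.pi * (v / (1 + v))) = √(2 * Real.pi * v) * √(1 / (1 + v)) := by
      rw [← Real.sqrt_mul (by positivity)]; congr 1; ring
    have h1 : √(1 / (1 + v)) ≠ 0 := (Real.sqrt_pos.2 (by positivity)).ne'
    have h2 : √(2 * Real.pi * v) ≠ 0 := (Real.sqrt_pos.2 (by positivity)).ne'
    have h3 : √(2 * Real.pi) ≠ 0 := (Real.sqrt_pos.2 (by positivity)).ne'
    simp only [gaussianPDFReal, Real.coe_toNNReal _ hv.le, Real.coe_toNNReal _ hv1.le, hs,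
      NNReal.coe_one, mul_one, smul_eq_mul]
    have he : Real.exp (-(μ - 0) ^ 2 / (2 * v)) * Real.exp (-(x - μ) ^ 2 / 2) =
        Real.exp (-(1 / (1 + v) * x ^ 2 / 2)) *
          Real.exp (-(μ - x * v / (1 + v)) ^ 2 / (2 * (v / (1 + v)))) := by
      rw [← Real.exp_add, ← Real.exp_add]; congr 1; field_simp; ring
    calc _ = (√(2 * Real.pi * v))⁻¹ * (√(2 * Real.pi))⁻¹ *
          (Real.exp (-(μ - 0) ^ 2 / (2 * v)) * Real.exp (-(x - μ) ^ 2 / 2)) := by ring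
      _ = _ := by rw [he]; field_simp
  simp_rw [key]
  rw [integral_const_mul, integral_gaussianPDFReal_eq_one _ (by simpa using hv1), mul_one]

lemma postMeanShrink_eq {τ x : ℝ} (hτ : 0 < τ) :
    postMeanShrink a K L x τ =
      (∫ t in Ioi 0, shrinkCoeff τ t * (shrinkKernel τ x t * localPrior a K L t)) /
        ∫ t in Ioi 0, shrinkKernel τ x t * localPrior a K L t := by
  have hc : (√(2 * Real.pi))⁻¹ ≠ 0 := inv_ne_zero (Real.sqrt_pos.2 (by positivity)).ne'
  have h1 : ∫ t in Ioi 0, shrinkCoeff τ t * likelihood τ x t * localPrior a K L t =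
      (√(2 * Real.pi))⁻¹ *
        ∫ t in Ioi 0, shrinkCoeff τ t * (shrinkKernel τ x t * localPrior a K L t) := by
    rw [← integral_const_mul]
    refine setIntegral_congr_fun measurableSet_Ioi fun t ht => ?_
    simp only [likelihood_eq hτ ht]; ring
  have h2 : ∫ t in Ioi 0, likelihood τ x t * localPrior a K L t =
      (√(2 * Real.pi))⁻¹ * ∫ t in Ioi 0, shrinkKernel τ x t * localPrior a K L t := by
    rw [← integral_const_mul]
    refine setIntegral_congr_fun measurableSet_Ioi fun t ht => ?_
    simp only [likelihood_eq hτ ht]; ring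
  rw [postMeanShrink, h1, h2, mul_div_mul_left _ _ hc]

lemma IsLocalPrior.integrableOn_mul (h : IsLocalPrior a K L) {f : ℝ → ℝ} (hf : Measurable f)
    (hf1 : ∀ t, 0 < t → |f t| ≤ 1) :
    IntegrableOn (fun t => f t * localPrior a K L t) (Ioi 0) := by
  refine Integrable.bdd_mul (c := 1) h.integrableOn hf.aestronglyMeasurable ?_
  exact (ae_restrict_iff' measurableSet_Ioi).2 (.of_forall fun t ht => hf1 t ht)

lemma IsLocalPrior.integrableOn_shrinkKernel_mul (h : IsLocalPrior a K L) (τ x : ℝ) :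
    IntegrableOn (fun t => shrinkKernel τ x t * localPrior a K L t) (Ioi 0) :=
  h.integrableOn_mul (measurable_shrinkKernel τ x) fun t ht => by
    rw [abs_of_pos (shrinkKernel_pos ht.le)]; exact shrinkKernel_le_one ht.le

lemma IsLocalPrior.integrableOn_shrinkCoeff_mul (h : IsLocalPrior a K L) (τ x : ℝ) :
    IntegrableOn (fun t => shrinkCoeff τ t * (shrinkKernel τ x t * localPrior a K L t))
      (Ioi 0) := by
  have := h.integrableOn_mul (f := fun t => shrinkCoeff τ t * shrinkKernel τ x t)
    ((measurable_shrinkCoeff τ).mul (measurable_shrinkKernel τ x)) fun t ht => by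
      rw [abs_of_pos (mul_pos (shrinkCoeff_pos ht.le) (shrinkKernel_pos ht.le))]
      exact mul_le_one₀ (shrinkCoeff_le_one ht.le) (shrinkKernel_pos ht.le).le
        (shrinkKernel_le_one ht.le)
  simpa only [mul_assoc] using this

lemma IsLocalPrior.integrableOn_sqrt_mul (h : IsLocalPrior a K L) (τ : ℝ) :
    IntegrableOn (fun t => √(shrinkCoeff τ t) * localPrior a K L t) (Ioi 0) :=
  h.integrableOn_mul (measurable_shrinkCoeff τ).sqrt fun t ht => by
    rw [abs_of_nonneg (Real.sqrt_nonneg _)]; exact Real.sqrt_le_one.2 (shrinkCoeff_le_one ht.le)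

lemma IsLocalPrior.integrableOn_signal (h : IsLocalPrior a K L) (τ : ℝ) :
    IntegrableOn (fun t => (1 - shrinkCoeff τ t) * √(shrinkCoeff τ t) * localPrior a K L t)
      (Ioi 0) :=
  h.integrableOn_mul (((measurable_const.sub (measurable_shrinkCoeff τ))).mul
      (measurable_shrinkCoeff τ).sqrt) fun t ht => by
    have h1 := shrinkCoeff_le_one (τ := τ) (le_of_lt ht)
    have h2 := shrinkCoeff_pos (τ := τ) (le_of_lt ht)
    rw [abs_of_nonneg (mul_nonneg (by linarith) (Real.sqrt_nonneg _))]
    exact mul_le_one₀ (by linarith) (Real.sqrt_nonneg _) (Real.sqrt_le_one.2 h1)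

lemma IsLocalPrior.tendsto_integral_sqrt (h : IsLocalPrior a K L) :
    Tendsto (fun τ => ∫ t in Ioi 0, √(shrinkCoeff τ t) * localPrior a K L t) (𝓝 0) (𝓝 1) := by
  rw [← h.integral_eq_one]
  refine tendsto_integral_filter_of_dominated_convergence (localPrior a K L)
    (.of_forall fun τ => (h.integrableOn_sqrt_mul τ).aestronglyMeasurable) (.of_forall fun τ => ?_)
    h.integrableOn ?_
  · refine (ae_restrict_iff' measurableSet_Ioi).2 (.of_forall fun t (ht : 0 < t) => ?_)
    rw [norm_mul, Real.norm_of_nonneg (Real.sqrt_nonneg _), Real.norm_of_nonneg (h.pos ht).le]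
    exact mul_le_of_le_one_left (h.pos ht).le (Real.sqrt_le_one.2 (shrinkCoeff_le_one ht.le))
  · refine (ae_restrict_iff' measurableSet_Ioi).2 (.of_forall fun t (ht : 0 < t) => ?_)
    have hc : ContinuousAt (fun τ => √(shrinkCoeff τ t) * localPrior a K L t) 0 := by
      unfold shrinkCoeff
      refine ContinuousAt.mul (ContinuousAt.sqrt ?_) continuousAt_const
      exact ContinuousAt.div (by fun_prop) (by fun_prop) (by simp)
    simpa [ContinuousAt, shrinkCoeff] using hc

/-- Rejection forces `exp(-x² / 2)` to be small: since `κ → 1` as `τ → 0`, the normalizing constant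
of the posterior is eventually at least `exp(-x² / 2) / 2`. -/
lemma IsLocalPrior.eventually_exp_lt (h : IsLocalPrior a K L) :
    ∀ᶠ τ in 𝓝[>] 0, ∀ x, 1 / 2 < 1 - postMeanShrink a K L x τ →
      Real.exp (-(x ^ 2 / 2)) < 4 * signalMass a K L τ := by
  have h0 := (h.tendsto_integral_sqrt.eventually_const_lt (u := 1 / 2) (by norm_num)).filter_mono
    (nhdsWithin_le_nhds (s := Ioi 0))
  filter_upwards [h0, self_mem_nhdsWithin] with τ hS (hτ : 0 < τ) x hx
  rw [postMeanShrink_eq hτ] at hx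
  set D := ∫ t in Ioi 0, shrinkKernel τ x t * localPrior a K L t with hD
  have hDge : Real.exp (-(x ^ 2 / 2)) *
      ∫ t in Ioi 0, √(shrinkCoeff τ t) * localPrior a K L t ≤ D := by
    rw [← integral_const_mul]
    refine setIntegral_mono_on ((h.integrableOn_sqrt_mul τ).const_mul _)
      (h.integrableOn_shrinkKernel_mul τ x) measurableSet_Ioi fun t (ht : 0 < t) => ?_
    rw [← mul_assoc]
    refine mul_le_mul_of_nonneg_right ?_ (h.pos ht).le
    rw [shrinkKernel, mul_comm]
    have := shrinkCoeff_le_one (τ := τ) ht.le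
    gcongr
    nlinarith [sq_nonneg x]
  have hexp := Real.exp_pos (-(x ^ 2 / 2))
  have hD0 : Real.exp (-(x ^ 2 / 2)) / 2 < D := by nlinarith
  have hJ : D - (∫ t in Ioi 0, shrinkCoeff τ t * (shrinkKernel τ x t * localPrior a K L t)) ≤
      signalMass a K L τ := by
    rw [hD, signalMass, ← integral_sub (h.integrableOn_shrinkKernel_mul τ x)
      (h.integrableOn_shrinkCoeff_mul τ x)]
    refine setIntegral_mono_on ((h.integrableOn_shrinkKernel_mul τ x).sub
      (h.integrableOn_shrinkCoeff_mul τ x)) (h.integrableOn_signal τ) measurableSet_Ioi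
      fun t (ht : 0 < t) => ?_
    have h1 := shrinkCoeff_le_one (τ := τ) ht.le
    have h2 : shrinkKernel τ x t ≤ √(shrinkCoeff τ t) := by
      refine mul_le_of_le_one_right (Real.sqrt_nonneg _) (Real.exp_le_one_iff.2 ?_)
      have := mul_nonneg (shrinkCoeff_pos (τ := τ) ht.le).le (sq_nonneg x)
      linarith
    calc _ = (1 - shrinkCoeff τ t) * shrinkKernel τ x t * localPrior a K L t := by ring
      _ ≤ _ := by
        refine mul_le_mul_of_nonneg_right ?_ (h.pos ht).le
        exact mul_le_mul_of_nonneg_left h2 (by linarith)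
  have hDpos : 0 < D := by linarith
  have : (∫ t in Ioi 0, shrinkCoeff τ t * (shrinkKernel τ x t * localPrior a K L t)) <
      1 / 2 * D := by
    rw [← div_lt_iff₀ hDpos]; linarith
  linarith

/-- Large observations are rejected: if `x² ≥ Q log(1/τ)` with `Q > 8a` then, for small `τ`, the
posterior mass of `κ > η` is negligible for some `η < 1/2`. It is compared with the mass of a window
in which `κ` is at most a small constant `s`; that window has prior mass at least
`τ ^ (2(a + s))`. -/
lemma IsLocalPrior.eventually_reject (h : IsLocalPrior a K L) (ha : 0 < a) {Q : ℝ}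
    (hQ : 8 * a < Q) :
    ∀ᶠ τ in 𝓝[>] 0, ∀ x, Q * (-Real.log τ) ≤ x ^ 2 →
      1 / 2 < 1 - postMeanShrink a K L x τ := by
  have hQ0 : 0 < Q := by linarith
  obtain ⟨s, hs0, hs8, hsQ⟩ : ∃ s, 0 < s ∧ s < 1 / 8 ∧ 4 * (a + s) < (1 / 2 - 2 * s) * Q := by
    refine ⟨(Q - 8 * a) / (8 * (Q + 2)), by apply div_pos <;> linarith, ?_, ?_⟩
    · rw [div_lt_iff₀ (by linarith)]; linarith
    · have e : (Q - 8 * a) / (8 * (Q + 2)) * (2 * Q + 4) = (Q - 8 * a) / 4 := by field_simp; ring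
      nlinarith
  obtain ⟨c, hc0, hc⟩ := h.exists_rpow_le_integral (b := a + s) (by linarith) (by linarith)
  -- The window is `X < t ≤ 4X` with `X = 1 / (s τ²)`.
  have hX : Tendsto (fun τ : ℝ => 1 / s * (τ ^ 2)⁻¹) (𝓝[>] 0) atTop := by
    refine Tendsto.const_mul_atTop (by positivity) ?_
    have : Tendsto (fun τ : ℝ => τ ^ 2) (𝓝[>] 0) (𝓝[>] 0) := by
      refine tendsto_nhdsWithin_iff.2 ⟨?_, ?_⟩
      · have : Tendsto (fun τ : ℝ => τ ^ 2) (𝓝 0) (𝓝 (0 ^ 2)) := (continuous_pow 2).tendsto 0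
        simpa using this.mono_left nhdsWithin_le_nhds
      · filter_upwards [self_mem_nhdsWithin] with τ hτ
        exact pow_pos (mem_Ioi.1 hτ) 2
    exact tendsto_inv_nhdsGT_zero.comp this
  set c' := √(1 / (1 + 4 / s)) * (c * (1 / s) ^ (-(a + s))) with hc'
  have hc'0 : 0 < c' := by
    rw [hc']; exact mul_pos (Real.sqrt_pos.2 (by positivity)) (by positivity)
  set e := (1 / 2 - 2 * s) * Q / 2 - 2 * (a + s) with he
  have he0 : 0 < e := by rw [he]; linarith
  have hsmall : Tendsto (fun τ : ℝ => τ ^ e) (𝓝[>] 0) (𝓝 0) := by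
    have := (Real.continuousAt_rpow_const 0 e (Or.inr he0.le)).tendsto
    rw [Real.zero_rpow he0.ne'] at this
    exact this.mono_left nhdsWithin_le_nhds
  filter_upwards [hX.eventually hc, hsmall.eventually_lt_const (mul_pos hs0 hc'0),
    self_mem_nhdsWithin] with τ hmass hτe (hτ : 0 < τ) x hx
  rw [postMeanShrink_eq hτ]
  set D := ∫ t in Ioi 0, shrinkKernel τ x t * localPrior a K L t with hD
  set X := 1 / s * (τ ^ 2)⁻¹ with hXd
  have hX0 : 0 < X := by positivity
  have hXτ : X * τ ^ 2 = 1 / s := by rw [hXd]; field_simp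
  have hDge : c' * τ ^ (2 * (a + s)) * Real.exp (-(s * x ^ 2 / 2)) ≤ D := by
    have h1 : ∫ t in X..4 * X, (√(1 / (1 + 4 / s)) * Real.exp (-(s * x ^ 2 / 2))) *
        localPrior a K L t ≤ D := by
      rw [intervalIntegral.integral_of_le (by linarith)]
      have hsub : Ioc X (4 * X) ⊆ Ioi 0 := fun t ht => hX0.trans ht.1
      refine le_trans (setIntegral_mono_on ((h.integrableOn.mono_set hsub).const_mul _)
        ((h.integrableOn_shrinkKernel_mul τ x).mono_set hsub) measurableSet_Ioc fun t ht => ?_)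
        (setIntegral_mono_set (h.integrableOn_shrinkKernel_mul τ x) ?_
          (.of_forall hsub))
      · have ht0 : 0 < t := hsub ht
        have hκ1 : shrinkCoeff τ t ≤ s := by
          rw [shrinkCoeff, div_le_iff₀ (by positivity)]
          have : 1 / s ≤ t * τ ^ 2 := by rw [← hXτ]; gcongr; exact ht.1.le
          have : 1 ≤ s * (t * τ ^ 2) := by rwa [div_le_iff₀' hs0] at this
          nlinarith
        have hκ2 : 1 / (1 + 4 / s) ≤ shrinkCoeff τ t := by
          rw [shrinkCoeff]
          refine one_div_le_one_div_of_le (by positivity) ?_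
          have : t * τ ^ 2 ≤ 4 * X * τ ^ 2 := by gcongr; exact ht.2
          have e4 : 4 * X * τ ^ 2 = 4 / s := by rw [mul_assoc, hXτ]; ring
          linarith
        refine mul_le_mul_of_nonneg_right ?_ (h.pos ht0).le
        rw [shrinkKernel]
        gcongr
      · exact (ae_restrict_iff' measurableSet_Ioi).2 (.of_forall fun t (ht : 0 < t) =>
          (mul_pos (shrinkKernel_pos ht.le) (h.pos ht)).le)
    refine le_trans ?_ h1
    rw [intervalIntegral.integral_const_mul]
    have h2 : X ^ (-(a + s)) = (1 / s) ^ (-(a + s)) * τ ^ (2 * (a + s)) := by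
      rw [hXd, Real.mul_rpow (by positivity) (by positivity), Real.inv_rpow (by positivity),
        Real.rpow_neg (sq_nonneg τ), inv_inv, Real.rpow_mul hτ.le]
      norm_cast
    calc _ = (√(1 / (1 + 4 / s)) * Real.exp (-(s * x ^ 2 / 2))) * (c * X ^ (-(a + s))) := by
          rw [h2, hc']; ring
      _ ≤ _ := by gcongr
  have hDpos : 0 < D := lt_of_lt_of_le (by positivity) hDge
  have hnum : ∫ t in Ioi 0, shrinkCoeff τ t * (shrinkKernel τ x t * localPrior a K L t) ≤
      (1 / 2 - s) * D + Real.exp (-((1 / 2 - s) * x ^ 2 / 2)) := by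
    have hi := ((h.integrableOn_shrinkKernel_mul τ x).const_mul (1 / 2 - s))
    have hi' := h.integrableOn.const_mul (Real.exp (-((1 / 2 - s) * x ^ 2 / 2)))
    calc _ ≤ ∫ t in Ioi 0, ((1 / 2 - s) * (shrinkKernel τ x t * localPrior a K L t) +
          Real.exp (-((1 / 2 - s) * x ^ 2 / 2)) * localPrior a K L t) := by
          refine setIntegral_mono_on (h.integrableOn_shrinkCoeff_mul τ x) (hi.add hi')
            measurableSet_Ioi fun t (ht : 0 < t) => ?_
          have hW := shrinkKernel_pos (τ := τ) (x := x) ht.le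
          have hπ := h.pos ht
          rw [← mul_assoc, ← mul_assoc, ← add_mul]
          refine mul_le_mul_of_nonneg_right ?_ hπ.le
          rcases le_total (shrinkCoeff τ t) (1 / 2 - s) with hκ | hκ
          · nlinarith [Real.exp_pos (-((1 / 2 - s) * x ^ 2 / 2))]
          · have h1 : shrinkKernel τ x t ≤ Real.exp (-((1 / 2 - s) * x ^ 2 / 2)) := by
              refine (shrinkKernel_le_exp ht.le).trans ?_
              gcongr
            have h2 := shrinkCoeff_le_one (τ := τ) ht.le
            nlinarith
      _ = _ := by
          rw [integral_add hi hi', integral_const_mul, integral_const_mul, h.integral_eq_one,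
            mul_one]
  have hexp : Real.exp (-((1 / 2 - s) * x ^ 2 / 2)) < s * D := by
    have h1 : Real.exp (-((1 / 2 - 2 * s) * x ^ 2 / 2)) ≤ τ ^ ((1 / 2 - 2 * s) * Q / 2) := by
      rw [Real.rpow_def_of_pos hτ]
      refine Real.exp_le_exp.2 ?_
      have : (1 / 2 - 2 * s) / 2 * (Q * (-Real.log τ)) ≤ (1 / 2 - 2 * s) / 2 * x ^ 2 := by
        gcongr; linarith
      linarith
    have h2 : τ ^ ((1 / 2 - 2 * s) * Q / 2) = τ ^ e * τ ^ (2 * (a + s)) := by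
      rw [← Real.rpow_add hτ, he]; ring_nf
    calc Real.exp (-((1 / 2 - s) * x ^ 2 / 2))
        = Real.exp (-((1 / 2 - 2 * s) * x ^ 2 / 2)) * Real.exp (-(s * x ^ 2 / 2)) := by
          rw [← Real.exp_add]; ring_nf
      _ ≤ τ ^ e * τ ^ (2 * (a + s)) * Real.exp (-(s * x ^ 2 / 2)) := by
          rw [← h2]; gcongr
      _ < s * c' * τ ^ (2 * (a + s)) * Real.exp (-(s * x ^ 2 / 2)) := by gcongr
      _ = s * (c' * τ ^ (2 * (a + s)) * Real.exp (-(s * x ^ 2 / 2))) := by ring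
      _ ≤ s * D := by gcongr
  have : (∫ t in Ioi 0, shrinkCoeff τ t * (shrinkKernel τ x t * localPrior a K L t)) / D <
      1 / 2 := by
    rw [div_lt_iff₀ hDpos]; linarith
  linarith

end Posterior

/-! ### The posterior mass of signals under small global shrinkage -/

section SignalMass

variable {a K : ℝ} {L : ℝ → ℝ}

lemma tendsto_neg_log_nhdsGT_zero : Tendsto (fun τ : ℝ => -Real.log τ) (𝓝[>] 0) atTop :=
  tendsto_neg_atBot_atTop.comp Real.tendsto_log_nhdsGT_zero

lemma signal_le {s : ℝ} (hs : 0 < s) : (1 - 1 / (1 + s)) * √(1 / (1 + s)) ≤ s := by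
  have h1 : 1 - 1 / (1 + s) ≤ s := by
    rw [one_sub_div (by positivity), div_le_iff₀ (by positivity)]; nlinarith
  have h2 : √(1 / (1 + s)) ≤ 1 := Real.sqrt_le_one.2 (by rw [div_le_one (by positivity)]; linarith)
  nlinarith [Real.sqrt_nonneg (1 / (1 + s))]

lemma signal_le_one {s : ℝ} (hs : 0 < s) : (1 - 1 / (1 + s)) * √(1 / (1 + s)) ≤ 1 := by
  have h1 : 1 - 1 / (1 + s) ≤ 1 := by
    have : 0 < 1 / (1 + s) := by positivity
    linarith
  exact mul_le_one₀ h1 (Real.sqrt_nonneg _)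
    (Real.sqrt_le_one.2 (by rw [div_le_one (by positivity)]; linarith))

lemma signal_le_rpow {s b : ℝ} (hs : 0 < s) (hb0 : 0 ≤ b) (hb1 : b ≤ 1) :
    (1 - 1 / (1 + s)) * √(1 / (1 + s)) ≤ s ^ b := by
  rcases le_total s 1 with h | h
  · calc _ ≤ s := signal_le hs
      _ = s ^ (1 : ℝ) := (Real.rpow_one s).symm
      _ ≤ s ^ b := Real.rpow_le_rpow_of_exponent_ge hs h hb1
  · exact (signal_le_one hs).trans (Real.one_le_rpow h hb0)

lemma signal_le_inv_sqrt {s : ℝ} (hs : 0 < s) :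
    (1 - 1 / (1 + s)) * √(1 / (1 + s)) ≤ s ^ (-(1 / 2) : ℝ) := by
  have h1 : 1 - 1 / (1 + s) ≤ 1 := by
    have : 0 < 1 / (1 + s) := by positivity
    linarith
  have h2 : √(1 / (1 + s)) ≤ s ^ (-(1 / 2) : ℝ) := by
    rw [Real.rpow_neg hs.le, ← Real.sqrt_eq_rpow, ← Real.sqrt_inv]
    refine Real.sqrt_le_sqrt ?_
    rw [← one_div]
    exact one_div_le_one_div_of_le hs (by linarith)
  exact (mul_le_of_le_one_left (Real.sqrt_nonneg _) h1).trans h2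

lemma IsLocalPrior.signalMass_le_rpow (h : IsLocalPrior a K L) {b τ : ℝ} (hb0 : 0 ≤ b)
    (hb1 : b ≤ 1) (hba : b < a) (hτ : 0 < τ) :
    signalMass a K L τ ≤ τ ^ (2 * b) * ∫ t in Ioi 0, t ^ b * localPrior a K L t := by
  rw [signalMass, ← integral_const_mul]
  refine setIntegral_mono_on (h.integrableOn_signal τ)
    ((h.integrableOn_rpow_mul hb0 hba).const_mul _) measurableSet_Ioi fun t (ht : 0 < t) => ?_
  rw [← mul_assoc]
  refine mul_le_mul_of_nonneg_right ?_ (h.pos ht).le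
  have h1 := signal_le_rpow (s := t * τ ^ 2) (by positivity) hb0 hb1
  rw [Real.mul_rpow ht.le (by positivity)] at h1
  have h2 : (τ ^ 2) ^ b = τ ^ (2 * b) := by rw [Real.rpow_mul hτ.le]; norm_cast
  rw [← h2]
  exact h1.trans_eq (mul_comm _ _)

lemma IsLocalPrior.eventually_signalMass_le_of_half_lt (h : IsLocalPrior a K L) (ha : 1 / 2 < a)
    (ha1 : a < 1) {δ : ℝ} (hδ : 0 < δ) :
    ∀ᶠ τ in 𝓝[>] 0, signalMass a K L τ ≤ δ * (τ * √(-Real.log τ)) := by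
  obtain ⟨b, hb, hba⟩ := exists_between ha
  have hsmall : Tendsto (fun τ : ℝ => τ ^ (2 * b - 1) *
      ∫ t in Ioi 0, t ^ b * localPrior a K L t) (𝓝[>] 0) (𝓝 0) := by
    have := (Real.continuousAt_rpow_const 0 (2 * b - 1) (Or.inr (by linarith))).tendsto
    rw [Real.zero_rpow (by linarith)] at this
    simpa using (this.mono_left nhdsWithin_le_nhds).mul_const _
  filter_upwards [hsmall.eventually_lt_const hδ, self_mem_nhdsWithin,
    tendsto_neg_log_nhdsGT_zero.eventually_ge_atTop 1] with τ h1 (hτ : 0 < τ) hlog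
  have hsq : 1 ≤ √(-Real.log τ) := Real.one_le_sqrt.2 hlog
  have e : τ ^ (2 * b) = τ ^ (2 * b - 1) * τ := by
    rw [Real.rpow_sub_one hτ.ne']; field_simp
  calc signalMass a K L τ ≤ τ ^ (2 * b) * ∫ t in Ioi 0, t ^ b * localPrior a K L t :=
        h.signalMass_le_rpow (by linarith) (by linarith) hba hτ
    _ = (τ ^ (2 * b - 1) * ∫ t in Ioi 0, t ^ b * localPrior a K L t) * τ := by rw [e]; ring
    _ ≤ δ * τ := by gcongr
    _ ≤ δ * (τ * √(-Real.log τ)) := by gcongr; exact le_mul_of_one_le_right hτ.le hsq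

/-- The borderline tail `a = 1/2`: the integral is split at `t = 1 / τ²`, where
`(1 - κ)√κ` changes from order `t τ²` to order `(t τ²) ^ (-1/2)`. -/
lemma IsLocalPrior.eventually_signalMass_le_of_half (h : IsLocalPrior (1 / 2) K L)
    (hL : Tendsto (fun t : ℝ => L t / √(Real.log t)) atTop (𝓝 0)) {δ : ℝ} (hδ : 0 < δ) :
    ∀ᶠ τ in 𝓝[>] 0, signalMass (1 / 2) K L τ ≤ δ * (τ * √(-Real.log τ)) := by
  have hK := h.K_pos
  set d := δ / (16 * K) with hd
  have hd0 : 0 < d := by positivity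
  obtain ⟨T, hT1, hT⟩ : ∃ T, 1 < T ∧ ∀ t, T ≤ t → L t ≤ d * √(Real.log t) := by
    obtain ⟨T, hT⟩ := eventually_atTop.1 (hL.eventually_lt_const hd0)
    refine ⟨max T 2, by simp, fun t ht => ?_⟩
    have h2 : 2 ≤ t := (le_max_right _ _).trans ht
    have h1 := hT t ((le_max_left _ _).trans ht)
    rw [div_lt_iff₀ (Real.sqrt_pos.2 (Real.log_pos (by linarith)))] at h1
    exact h1.le
  have hT0 : 0 < T := by linarith
  have hnear : Tendsto (fun τ : ℝ => T * τ) (𝓝[>] 0) (𝓝 0) := by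
    have : Tendsto (fun τ : ℝ => T * τ) (𝓝 0) (𝓝 (T * 0)) := (continuous_const_mul T).tendsto 0
    rw [mul_zero] at this
    exact this.mono_left nhdsWithin_le_nhds
  filter_upwards [self_mem_nhdsWithin, tendsto_neg_log_nhdsGT_zero.eventually_ge_atTop 1,
    tendsto_neg_log_nhdsGT_zero.eventually_gt_atTop (Real.log T),
    hnear.eventually_lt_const (half_pos hδ)] with τ (hτ : 0 < τ) hlog hlogT hTτ
  set ℓ := -Real.log τ with hℓ
  have hsq : 1 ≤ √ℓ := Real.one_le_sqrt.2 hlog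
  set R := (τ ^ 2)⁻¹ with hR
  have hR0 : 0 < R := by positivity
  have hlogR : Real.log R = 2 * ℓ := by rw [hR, Real.log_inv, Real.log_pow, hℓ]; push_cast; ring
  have hRτ : R * τ ^ 2 = 1 := by rw [hR]; field_simp
  set c := K * d * √(2 * ℓ) with hc
  have hc0 : 0 < c := by
    rw [hc]; exact mul_pos (by positivity) (Real.sqrt_pos.2 (by linarith))
  have hπ : ∀ t, T < t → localPrior (1 / 2) K L t ≤
      K * t ^ (-(3 / 2) : ℝ) * (d * √(Real.log t)) := by
    intro t ht
    have ht0 : 0 < t := hT0.trans ht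
    rw [localPrior, show (-(1 / 2) - 1 : ℝ) = -(3 / 2) by norm_num]
    gcongr
    exact hT t ht.le
  have hlow : ∀ t, 0 < t → t ≤ R → (1 - shrinkCoeff τ t) * √(shrinkCoeff τ t) *
      localPrior (1 / 2) K L t ≤
        τ ^ 2 * T * localPrior (1 / 2) K L t + c * τ ^ 2 * t ^ (-(1 / 2) : ℝ) := by
    intro t ht0 htR
    have hs := signal_le (s := t * τ ^ 2) (by positivity)
    have hp := h.pos ht0
    have hn2 : 0 ≤ c * τ ^ 2 * t ^ (-(1 / 2) : ℝ) := by positivity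
    have hn1 : 0 ≤ τ ^ 2 * T * localPrior (1 / 2) K L t := by positivity
    have hle : (1 - shrinkCoeff τ t) * √(shrinkCoeff τ t) * localPrior (1 / 2) K L t ≤
        t * τ ^ 2 * localPrior (1 / 2) K L t := mul_le_mul_of_nonneg_right hs hp.le
    rcases le_or_gt t T with htT | htT
    · have : t * τ ^ 2 * localPrior (1 / 2) K L t ≤ τ ^ 2 * T * localPrior (1 / 2) K L t := by
        rw [mul_comm t]; gcongr
      linarith
    · have h1 : √(Real.log t) ≤ √(2 * ℓ) := by
        refine Real.sqrt_le_sqrt ?_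
        rw [← hlogR]; exact Real.log_le_log ht0 htR
      have h2 : t * t ^ (-(3 / 2) : ℝ) = t ^ (-(1 / 2) : ℝ) := by
        rw [← Real.rpow_one_add' ht0.le (by norm_num)]; norm_num
      have : t * τ ^ 2 * localPrior (1 / 2) K L t ≤ c * τ ^ 2 * t ^ (-(1 / 2) : ℝ) := by
        calc _ ≤ t * τ ^ 2 * (K * t ^ (-(3 / 2) : ℝ) * (d * √(2 * ℓ))) := by
              gcongr; exact (hπ t htT).trans (by gcongr)
          _ = c * τ ^ 2 * (t * t ^ (-(3 / 2) : ℝ)) := by rw [hc]; ring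
          _ = _ := by rw [h2]
      linarith
  have hTR : T < R := by
    refine (Real.log_lt_log_iff hT0 hR0).1 ?_
    rw [hlogR]
    linarith
  have hhigh : ∀ t, R < t → (1 - shrinkCoeff τ t) * √(shrinkCoeff τ t) *
      localPrior (1 / 2) K L t ≤ c * t ^ (-(3 / 2) : ℝ) := by
    intro t htR
    have ht0 : 0 < t := hR0.trans htR
    have hst : 0 < t * τ ^ 2 := by positivity
    have hs1 : 1 < t * τ ^ 2 := by rw [← hRτ]; gcongr
    have hlogt : Real.log t ≤ 2 * ℓ * (t * τ ^ 2) := by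
      have e : Real.log t = Real.log (t * τ ^ 2) + 2 * ℓ := by
        rw [Real.log_mul ht0.ne' (by positivity), Real.log_pow, hℓ]; push_cast; ring
      have := Real.log_le_sub_one_of_pos hst
      nlinarith
    have hsqrt : √(Real.log t) ≤ √(2 * ℓ) * √(t * τ ^ 2) := by
      rw [← Real.sqrt_mul (by linarith)]; exact Real.sqrt_le_sqrt hlogt
    have hone : (t * τ ^ 2) ^ (-(1 / 2) : ℝ) * √(t * τ ^ 2) = 1 := by
      rw [Real.sqrt_eq_rpow, ← Real.rpow_add hst]; norm_num
    calc _ ≤ (t * τ ^ 2) ^ (-(1 / 2) : ℝ) *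
          (K * t ^ (-(3 / 2) : ℝ) * (d * (√(2 * ℓ) * √(t * τ ^ 2)))) := by
          refine mul_le_mul (signal_le_inv_sqrt hst) ?_ (h.pos ht0).le (by positivity)
          exact (hπ t (hTR.trans htR)).trans (by gcongr)
      _ = c * t ^ (-(3 / 2) : ℝ) * ((t * τ ^ 2) ^ (-(1 / 2) : ℝ) * √(t * τ ^ 2)) := by
          rw [hc]; ring
      _ = _ := by rw [hone, mul_one]
  have hi := h.integrableOn_signal τ
  have hRr : R ^ (1 / 2 : ℝ) = τ⁻¹ := by
    rw [← Real.sqrt_eq_rpow, hR, Real.sqrt_inv, Real.sqrt_sq hτ.le]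
  have hI1 : ∫ t in Ioc 0 R, (1 - shrinkCoeff τ t) * √(shrinkCoeff τ t) *
      localPrior (1 / 2) K L t ≤ τ ^ 2 * T + 2 * c * τ := by
    have hj1 : IntegrableOn (fun t => τ ^ 2 * T * localPrior (1 / 2) K L t) (Ioc 0 R) :=
      (h.integrableOn.mono_set Ioc_subset_Ioi_self).const_mul _
    have hj2 : IntegrableOn (fun t => c * τ ^ 2 * t ^ (-(1 / 2) : ℝ)) (Ioc 0 R) := by
      refine Integrable.const_mul ?_ _
      exact (intervalIntegrable_iff_integrableOn_Ioc_of_le hR0.le).1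
        (intervalIntegral.intervalIntegrable_rpow' (by norm_num))
    calc _ ≤ ∫ t in Ioc 0 R, (τ ^ 2 * T * localPrior (1 / 2) K L t +
          c * τ ^ 2 * t ^ (-(1 / 2) : ℝ)) :=
          setIntegral_mono_on (hi.mono_set Ioc_subset_Ioi_self) (hj1.add hj2) measurableSet_Ioc
            fun t ht => hlow t ht.1 ht.2
      _ = τ ^ 2 * T * (∫ t in Ioc 0 R, localPrior (1 / 2) K L t) +
          c * τ ^ 2 * ∫ t in Ioc 0 R, t ^ (-(1 / 2) : ℝ) := by
          rw [integral_add hj1 hj2, integral_const_mul, integral_const_mul]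
      _ ≤ τ ^ 2 * T * 1 + c * τ ^ 2 * (2 * τ⁻¹) := by
          have hm : ∫ t in Ioc 0 R, localPrior (1 / 2) K L t ≤ 1 := by
            refine le_of_le_of_eq ?_ h.integral_eq_one
            exact setIntegral_mono_set h.integrableOn ((ae_restrict_iff' measurableSet_Ioi).2
              (.of_forall fun t ht => (h.pos ht).le)) (.of_forall Ioc_subset_Ioi_self)
          have hr : ∫ t in Ioc 0 R, t ^ (-(1 / 2) : ℝ) = 2 * τ⁻¹ := by
            rw [← intervalIntegral.integral_of_le hR0.le, integral_rpow (Or.inl (by norm_num)),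
              Real.zero_rpow (by norm_num), show (-(1 / 2) + 1 : ℝ) = 1 / 2 by norm_num, hRr]
            ring
          rw [hr]; gcongr
      _ = _ := by field_simp
  have hI2 : ∫ t in Ioi R, (1 - shrinkCoeff τ t) * √(shrinkCoeff τ t) *
      localPrior (1 / 2) K L t ≤ 2 * c * τ := by
    have hr : ∫ t in Ioi R, t ^ (-(3 / 2) : ℝ) = 2 * τ := by
      rw [integral_Ioi_rpow_of_lt (by norm_num) hR0,
        show (-(3 / 2) + 1 : ℝ) = -(1 / 2) by norm_num, Real.rpow_neg hR0.le, hRr]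
      field_simp
    calc _ ≤ ∫ t in Ioi R, c * t ^ (-(3 / 2) : ℝ) :=
          setIntegral_mono_on (hi.mono_set (Ioi_subset_Ioi hR0.le))
            ((integrableOn_Ioi_rpow_of_lt (by norm_num) hR0).const_mul c) measurableSet_Ioi
            fun t ht => hhigh t ht
      _ = _ := by rw [integral_const_mul, hr]; ring
  rw [signalMass, ← Ioc_union_Ioi_eq_Ioi hR0.le, setIntegral_union (Ioc_disjoint_Ioi le_rfl)
    measurableSet_Ioi (hi.mono_set Ioc_subset_Ioi_self) (hi.mono_set (Ioi_subset_Ioi hR0.le))]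
  have hcle : c ≤ δ / 8 * √ℓ := by
    have : √(2 * ℓ) ≤ 2 * √ℓ := by
      rw [Real.sqrt_le_left (by positivity), mul_pow, Real.sq_sqrt (by linarith)]; linarith
    calc c ≤ K * d * (2 * √ℓ) := by rw [hc]; gcongr
      _ = _ := by rw [hd]; field_simp; ring
  calc _ ≤ (T * τ) * τ + 4 * c * τ := by linarith [hI1, hI2, sq τ]
    _ ≤ δ / 2 * √ℓ * τ + 4 * (δ / 8 * √ℓ) * τ := by
        have hTδ : T * τ ≤ δ / 2 * √ℓ :=
          hTτ.le.trans (le_mul_of_one_le_right (by positivity) hsq)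
        gcongr
    _ = _ := by ring

/-- Rejection at `x` for a small `τ` forces `exp(-x² / 2) = o(τ √(log(1/τ)))`. -/
lemma IsLocalPrior.eventually_exp_le (h : IsLocalPrior a K L)
    (ha : (1 / 2 < a ∧ a < 1) ∨
      (a = 1 / 2 ∧ Tendsto (fun t : ℝ => L t / √(Real.log t)) atTop (𝓝 0))) {δ : ℝ} (hδ : 0 < δ) :
    ∀ᶠ τ in 𝓝[>] 0, ∀ x, 1 / 2 < 1 - postMeanShrink a K L x τ →
      Real.exp (-(x ^ 2 / 2)) ≤ δ * (τ * √(-Real.log τ)) := by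
  have hδ4 : 0 < δ / 4 := by positivity
  have hJ : ∀ᶠ τ in 𝓝[>] 0, signalMass a K L τ ≤ δ / 4 * (τ * √(-Real.log τ)) := by
    rcases ha with ⟨h1, h2⟩ | ⟨rfl, hL⟩
    · exact h.eventually_signalMass_le_of_half_lt h1 h2 hδ4
    · exact h.eventually_signalMass_le_of_half hL hδ4
  filter_upwards [h.eventually_exp_lt, hJ] with τ h1 h2 x hx
  linarith [h1 x hx]

end SignalMass

/-! ### Gaussian tail estimates -/

lemma gaussianReal_real_Ici_le {y : ℝ} (hy : 0 < y) :
    (gaussianReal 0 1).real (Ici y) ≤ Real.exp (-(y ^ 2 / 2)) / (2 * y) := by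
  have hpi : (√(2 * Real.pi))⁻¹ ≤ 1 / 2 := by
    rw [← one_div]
    refine one_div_le_one_div_of_le two_pos (Real.le_sqrt_of_sq_le ?_)
    nlinarith [Real.pi_gt_three]
  have hderiv : ∀ x ∈ Ici y, HasDerivAt (fun x : ℝ => -Real.exp (-(x ^ 2 / 2)))
      (x * Real.exp (-(x ^ 2 / 2))) x := by
    intro x _
    have h1 : HasDerivAt (fun x : ℝ => -(x ^ 2 / 2)) (-x) x := by
      exact ((hasDerivAt_pow 2 x).div_const 2).neg.congr_deriv (by simp)
    exact h1.exp.neg.congr_deriv (by ring)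
  have hlim : Tendsto (fun x : ℝ => -Real.exp (-(x ^ 2 / 2))) atTop (𝓝 0) := by
    have h1 : Tendsto (fun x : ℝ => x ^ 2 / 2) atTop atTop :=
      (tendsto_pow_atTop two_ne_zero).atTop_div_const two_pos
    simpa using (Real.tendsto_exp_neg_atTop_nhds_zero.comp h1).neg
  have hnn : ∀ x ∈ Ioi y, 0 ≤ x * Real.exp (-(x ^ 2 / 2)) := fun x hx =>
    mul_nonneg (hy.trans hx).le (Real.exp_pos _).le
  have hint := integrableOn_Ioi_deriv_of_nonneg' hderiv hnn hlim
  have hval := integral_Ioi_of_hasDerivAt_of_tendsto' hderiv hint hlim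
  rw [measureReal_def, gaussianReal_apply_eq_integral _ one_ne_zero, ENNReal.toReal_ofReal
    (integral_nonneg fun x => gaussianPDFReal_nonneg _ _ _), integral_Ici_eq_integral_Ioi]
  calc ∫ x in Ioi y, gaussianPDFReal 0 1 x
      ≤ ∫ x in Ioi y, 1 / (2 * y) * (x * Real.exp (-(x ^ 2 / 2))) := by
        refine setIntegral_mono_on (integrable_gaussianPDFReal 0 1).integrableOn
          (hint.const_mul _) measurableSet_Ioi fun x (hx : y < x) => ?_
        have e : gaussianPDFReal 0 1 x = (√(2 * Real.pi))⁻¹ * Real.exp (-(x ^ 2 / 2)) := by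
          simp [gaussianPDFReal, neg_div]
        rw [e, ← mul_assoc]
        refine mul_le_mul_of_nonneg_right (hpi.trans ?_) (Real.exp_pos _).le
        rw [div_mul_eq_mul_div, one_mul, div_le_div_iff₀ two_pos (by positivity)]
        linarith
    _ = _ := by rw [integral_const_mul, hval]; ring

lemma gaussianReal_real_neg (s : Set ℝ) (hs : MeasurableSet s) :
    (gaussianReal 0 1).real (Neg.neg ⁻¹' s) = (gaussianReal 0 1).real s := by
  have h : (gaussianReal 0 1).map (fun x => -x) = gaussianReal 0 1 := by
    rw [gaussianReal_map_neg, neg_zero]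
  conv_rhs => rw [← h, map_measureReal_apply measurable_neg hs]

/-- Mills' bound for the two-sided standard normal tail. -/
lemma gaussianReal_real_le_abs {y : ℝ} (hy : 0 < y) :
    (gaussianReal 0 1).real {x | y ≤ |x|} ≤ Real.exp (-(y ^ 2 / 2)) / y := by
  have hset : {x : ℝ | y ≤ |x|} = Ici y ∪ Neg.neg ⁻¹' Ici y := by
    ext x; simp [le_abs, le_neg]
  have h1 := gaussianReal_real_Ici_le hy
  have h2 := measureReal_union_le (μ := gaussianReal 0 1) (Ici y) (Neg.neg ⁻¹' Ici y)
  rw [gaussianReal_real_neg _ measurableSet_Ici, ← hset] at h2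
  have e : Real.exp (-(y ^ 2 / 2)) / y = 2 * (Real.exp (-(y ^ 2 / 2)) / (2 * y)) := by field_simp
  linarith

lemma gaussianReal_real_sq_le {r : ℝ} (hr : 0 ≤ r) :
    (gaussianReal 0 1).real {z | z ^ 2 ≤ r} = 2 * stdNormalCDF √r - 1 := by
  have hset : {z : ℝ | z ^ 2 ≤ r} = Iic √r \ Neg.neg ⁻¹' (Ioi √r) := by
    ext z
    simp only [mem_ofPred_eq, Set.mem_sdiff, mem_Iic, mem_preimage, mem_Ioi, not_lt]
    rw [Real.sq_le hr]
    constructor <;> rintro ⟨h1, h2⟩ <;> constructor <;> linarith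
  have hsub : Neg.neg ⁻¹' (Ioi √r) ⊆ Iic √r := by
    intro z hz
    have : √r < -z := hz
    have := Real.sqrt_nonneg r
    simp only [mem_Iic]; linarith
  rw [hset, measureReal_sdiff hsub (measurable_neg measurableSet_Ioi),
    gaussianReal_real_neg _ measurableSet_Ioi, ← compl_Iic,
    probReal_compl_eq_one_sub measurableSet_Iic, stdNormalCDF, cdf_eq_real]
  ring

lemma gaussianReal_real_pos_of_isOpen {s : Set ℝ} (hs : IsOpen s) (hne : s.Nonempty) :
    0 < (gaussianReal 0 1).real s := by
  refine ENNReal.toReal_pos (fun h => ?_) (measure_ne_top _ _)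
  exact (hs.measure_pos volume hne).ne' (gaussianReal_absolutelyContinuous' 0 one_ne_zero h)

lemma gaussianReal_real_sq_le_pos {r : ℝ} (hr : 0 < r) :
    0 < (gaussianReal 0 1).real {z | z ^ 2 ≤ r} := by
  refine (gaussianReal_real_pos_of_isOpen (s := {z | z ^ 2 < r})
    (isOpen_lt (by fun_prop) (by fun_prop)) ⟨0, by simpa using hr⟩).trans_le ?_
  exact measureReal_mono fun z (hz : z ^ 2 < r) => hz.le

lemma gaussianReal_real_scale {w : ℝ} (hw : 0 ≤ w) {s : Set ℝ} (hs : MeasurableSet s) :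
    (gaussianReal 0 (Real.toNNReal w)).real s = (gaussianReal 0 1).real {z | √w * z ∈ s} := by
  have h : (gaussianReal 0 1).map (fun z => √w * z) = gaussianReal 0 (Real.toNNReal w) := by
    rw [gaussianReal_map_const_mul]
    congr 1
    · simp
    · ext; simp [Real.sq_sqrt hw, hw]
  rw [← h, map_measureReal_apply (by fun_prop) hs]
  rfl

/-! ### The two-groups model -/

section Model

variable {m : ℕ} {p ψ : ℝ}

lemma isProbabilityMeasure_twoGroupsPair (hp : 0 < p ∧ p < 1) :
    IsProbabilityMeasure (twoGroupsPair p ψ) := by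
  refine ⟨?_⟩
  simp only [twoGroupsPair, Measure.add_apply, Measure.smul_apply, measure_univ, smul_eq_mul,
    mul_one]
  rw [← ENNReal.ofReal_add (by linarith [hp.2]) hp.1.le]
  simp

lemma twoGroupsPair_real_false (hp : 0 < p ∧ p < 1) (s : Set ℝ) :
    (twoGroupsPair p ψ).real ({false} ×ˢ s) = (1 - p) * (gaussianReal 0 1).real s := by
  rw [measureReal_def, twoGroupsPair, Measure.add_apply, Measure.smul_apply, Measure.smul_apply,
    Measure.prod_prod, Measure.prod_prod]
  simp [measureReal_def, hp.2.le]

lemma twoGroupsPair_real_true (hp : 0 < p ∧ p < 1) (s : Set ℝ) :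
    (twoGroupsPair p ψ).real ({true} ×ˢ s) =
      p * (gaussianReal 0 (Real.toNNReal (1 + ψ ^ 2))).real s := by
  rw [measureReal_def, twoGroupsPair, Measure.add_apply, Measure.smul_apply, Measure.smul_apply,
    Measure.prod_prod, Measure.prod_prod]
  simp [measureReal_def, hp.1.le]

lemma twoGroupsPair_real_snd (hp : 0 < p ∧ p < 1) {s : Set ℝ} (hs : MeasurableSet s) :
    (twoGroupsPair p ψ).real {w | w.2 ∈ s} = (1 - p) * (gaussianReal 0 1).real s +
      p * (gaussianReal 0 (Real.toNNReal (1 + ψ ^ 2))).real s := by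
  have := isProbabilityMeasure_twoGroupsPair (ψ := ψ) hp
  have hset : {w : Bool × ℝ | w.2 ∈ s} = {false} ×ˢ s ∪ {true} ×ˢ s := by
    ext ⟨b, x⟩; cases b <;> simp
  rw [hset, measureReal_union (by
      rw [Set.disjoint_left]; rintro ⟨b, x⟩ h1 h2; simp_all)
    ((measurableSet_singleton _).prod hs), twoGroupsPair_real_false hp, twoGroupsPair_real_true hp]

lemma isProbabilityMeasure_twoGroups (hp : 0 < p ∧ p < 1) :
    IsProbabilityMeasure (twoGroups m p ψ) := by
  have := isProbabilityMeasure_twoGroupsPair (ψ := ψ) hp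
  unfold twoGroups; infer_instance

lemma twoGroups_real_eval (hp : 0 < p ∧ p < 1) (i : Fin m) {A : Set (Bool × ℝ)}
    (hA : MeasurableSet A) :
    (twoGroups m p ψ).real {ω | ω i ∈ A} = (twoGroupsPair p ψ).real A := by
  have := isProbabilityMeasure_twoGroupsPair (ψ := ψ) hp
  have h := (measurePreserving_eval (fun _ : Fin m => twoGroupsPair p ψ) i).measure_preimage
    hA.nullMeasurableSet
  exact congrArg ENNReal.toReal h

lemma twoGroups_real_fst (hp : 0 < p ∧ p < 1) (i : Fin m) :
    (twoGroups m p ψ).real {ω | (ω i).1 = false} = 1 - p ∧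
      (twoGroups m p ψ).real {ω | (ω i).1 = true} = p := by
  have h : ∀ b : Bool, {ω : Fin m → Bool × ℝ | (ω i).1 = b} =
      {ω | ω i ∈ ({b} : Set Bool) ×ˢ (univ : Set ℝ)} := by intro b; ext; simp
  have hm : ∀ b : Bool, MeasurableSet (({b} : Set Bool) ×ˢ (univ : Set ℝ)) := fun b =>
    (measurableSet_singleton _).prod MeasurableSet.univ
  rw [h, h, twoGroups_real_eval hp i (hm _), twoGroups_real_eval hp i (hm _),
    twoGroupsPair_real_false hp, twoGroupsPair_real_true hp]
  simp

lemma measurableSet_fst_eq (i : Fin m) (b : Bool) :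
    MeasurableSet {ω : Fin m → Bool × ℝ | (ω i).1 = b} :=
  ((measurable_pi_apply i).fst (measurableSet_singleton b))

lemma mul_typeI (hp : 0 < p ∧ p < 1) (d : Rule m) (i : Fin m) :
    (1 - p) * typeI p ψ d i =
      (twoGroups m p ψ).real ({ω | (ω i).1 = false} ∩ {ω | obs ω ∈ d i}) := by
  have h := (twoGroups_real_fst (ψ := ψ) hp i).1
  rw [typeI, measureReal_def, cond_apply (measurableSet_fst_eq i false), ENNReal.toReal_mul,
    ENNReal.toReal_inv, ← measureReal_def, ← measureReal_def, h]
  have : 1 - p ≠ 0 := by linarith [hp.2]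
  field_simp

lemma mul_typeII (hp : 0 < p ∧ p < 1) (d : Rule m) (i : Fin m) :
    p * typeII p ψ d i =
      (twoGroups m p ψ).real ({ω | (ω i).1 = true} ∩ {ω | obs ω ∉ d i}) := by
  have h := (twoGroups_real_fst (ψ := ψ) hp i).2
  rw [typeII, measureReal_def, cond_apply (measurableSet_fst_eq i true), ENNReal.toReal_mul,
    ENNReal.toReal_inv, ← measureReal_def, ← measureReal_def, h]
  have : p ≠ 0 := hp.1.ne'
  field_simp

/-- If, outside an event `B`, the `i`-th hypothesis is rejected only for observations in `S` and
always for observations outside `S'`, then the risk is controlled by the Gaussian measures of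
`S`, `S'` and by the probability of `B`. -/
lemma bayesRisk_le (hp : 0 < p ∧ p < 1) (d : Rule m) {S S' : Set ℝ} (hS : MeasurableSet S)
    (hS' : MeasurableSet S') (B : Set (Fin m → Bool × ℝ))
    (h1 : ∀ ω ∉ B, ∀ i, obs ω ∈ d i → (ω i).2 ∈ S)
    (h2 : ∀ ω ∉ B, ∀ i, obs ω ∉ d i → (ω i).2 ∈ S') :
    bayesRisk p ψ d ≤ m * ((gaussianReal 0 1).real S +
      p * (gaussianReal 0 (Real.toNNReal (1 + ψ ^ 2))).real S' +
        2 * (twoGroups m p ψ).real B) := by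
  have := isProbabilityMeasure_twoGroups (m := m) (ψ := ψ) hp
  have hterm : ∀ i, (1 - p) * typeI p ψ d i + p * typeII p ψ d i ≤ (gaussianReal 0 1).real S +
      p * (gaussianReal 0 (Real.toNNReal (1 + ψ ^ 2))).real S' +
        2 * (twoGroups m p ψ).real B := by
    intro i
    have hsub1 : {ω | (ω i).1 = false} ∩ {ω | obs ω ∈ d i} ⊆
        {ω : Fin m → Bool × ℝ | ω i ∈ ({false} : Set Bool) ×ˢ S} ∪ B := by
      rintro ω ⟨hν, hd⟩
      by_cases hB : ω ∈ B
      · exact Or.inr hB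
      · exact Or.inl ⟨hν, h1 ω hB i hd⟩
    have hsub2 : {ω | (ω i).1 = true} ∩ {ω | obs ω ∉ d i} ⊆
        {ω : Fin m → Bool × ℝ | ω i ∈ ({true} : Set Bool) ×ˢ S'} ∪ B := by
      rintro ω ⟨hν, hd⟩
      by_cases hB : ω ∈ B
      · exact Or.inr hB
      · exact Or.inl ⟨hν, h2 ω hB i hd⟩
    have e1 := (measureReal_mono (μ := twoGroups m p ψ) hsub1).trans (measureReal_union_le _ _)
    have e2 := (measureReal_mono (μ := twoGroups m p ψ) hsub2).trans (measureReal_union_le _ _)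
    rw [← mul_typeI hp, twoGroups_real_eval hp i ((measurableSet_singleton _).prod hS),
      twoGroupsPair_real_false hp] at e1
    rw [← mul_typeII hp, twoGroups_real_eval hp i ((measurableSet_singleton _).prod hS'),
      twoGroupsPair_real_true hp] at e2
    have e3 : (1 - p) * (gaussianReal 0 1).real S ≤ (gaussianReal 0 1).real S :=
      mul_le_of_le_one_left measureReal_nonneg (by linarith [hp.1])
    linarith
  calc bayesRisk p ψ d ≤ ∑ _i : Fin m, ((gaussianReal 0 1).real S +
      p * (gaussianReal 0 (Real.toNNReal (1 + ψ ^ 2))).real S' +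
        2 * (twoGroups m p ψ).real B) := Finset.sum_le_sum fun i _ => hterm i
    _ = _ := by rw [Finset.sum_const, Finset.card_univ, Fintype.card_fin, nsmul_eq_mul]

/-- The risk is at least the contribution of the type II errors on any set `S` of observations for
which no hypothesis is rejected. -/
lemma le_bayesRisk (hp : 0 < p ∧ p < 1) (d : Rule m) {S : Set ℝ} (hS : MeasurableSet S)
    (h : ∀ (x : Fin m → ℝ) (i), x i ∈ S → x ∉ d i) :
    m * p * (gaussianReal 0 (Real.toNNReal (1 + ψ ^ 2))).real S ≤ bayesRisk p ψ d := by
  have := isProbabilityMeasure_twoGroups (m := m) (ψ := ψ) hp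
  have hterm : ∀ i, p * (gaussianReal 0 (Real.toNNReal (1 + ψ ^ 2))).real S ≤
      (1 - p) * typeI p ψ d i + p * typeII p ψ d i := by
    intro i
    rw [mul_typeI hp, mul_typeII hp, ← twoGroupsPair_real_true hp,
      ← twoGroups_real_eval hp i ((measurableSet_singleton _).prod hS)]
    have hsub : {ω : Fin m → Bool × ℝ | ω i ∈ ({true} : Set Bool) ×ˢ S} ⊆
        {ω | (ω i).1 = true} ∩ {ω | obs ω ∉ d i} := fun ω hω =>
      ⟨hω.1, h (obs ω) i hω.2⟩
    have h1 := measureReal_mono (μ := twoGroups m p ψ) hsub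
    have h2 : 0 ≤ (twoGroups m p ψ).real ({ω | (ω i).1 = false} ∩ {ω | obs ω ∈ d i}) :=
      measureReal_nonneg
    linarith
  calc _ = ∑ _i : Fin m, p * (gaussianReal 0 (Real.toNNReal (1 + ψ ^ 2))).real S := by
        simp [mul_assoc]
    _ ≤ _ := Finset.sum_le_sum fun i _ => hterm i

/-! ### Concentration of the number of exceedances -/

/-- The number of observations exceeding `y` in absolute value. -/
noncomputable def exceedances (y : ℝ) (x : Fin m → ℝ) : ℝ :=
  ∑ j, if y < |x j| then (1 : ℝ) else 0

lemma measurableSet_lt_abs (y : ℝ) : MeasurableSet {x : ℝ | y < |x|} :=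
  measurableSet_lt measurable_const measurable_norm

lemma measurable_exceedance (y : ℝ) :
    Measurable fun w : Bool × ℝ => if y < |w.2| then (1 : ℝ) else 0 :=
  Measurable.ite (measurable_snd (measurableSet_lt_abs y)) measurable_const measurable_const

lemma measurable_exceedances (y : ℝ) :
    Measurable fun ω : Fin m → Bool × ℝ => exceedances y (obs ω) :=
  Finset.measurable_sum _ fun j _ => (measurable_exceedance y).comp (measurable_pi_apply j)

lemma abs_mul_exceedances_le (s y : ℝ) (x : Fin m → ℝ) :
    s * exceedances y x ≤ |s| * m := by
  have h0 : 0 ≤ exceedances y x := Finset.sum_nonneg fun j _ => by split_ifs <;> simp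
  have h1 : exceedances y x ≤ m := by
    calc exceedances y x ≤ ∑ _j : Fin m, (1 : ℝ) :=
          Finset.sum_le_sum fun j _ => by split_ifs <;> simp
      _ = m := by simp
  calc s * exceedances y x ≤ |s| * exceedances y x := by gcongr; exact le_abs_self s
    _ ≤ _ := by gcongr

lemma integrable_exp_exceedances (hp : 0 < p ∧ p < 1) (s y : ℝ) :
    Integrable (fun ω => Real.exp (s * exceedances y (obs ω))) (twoGroups m p ψ) := by
  have := isProbabilityMeasure_twoGroups (m := m) (ψ := ψ) hp
  refine Integrable.of_bound ((measurable_exceedances y).const_mul s).exp.aestronglyMeasurable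
    (Real.exp (|s| * m)) (.of_forall fun ω => ?_)
  rw [Real.norm_of_nonneg (Real.exp_pos _).le]
  exact Real.exp_le_exp.2 (abs_mul_exceedances_le s y _)

/-- The number of exceedances is binomial; its moment generating function is at most that of the
Poisson law with the same mean. -/
lemma mgf_exceedances_le (hp : 0 < p ∧ p < 1) (s y : ℝ) :
    mgf (fun ω => exceedances y (obs ω)) (twoGroups m p ψ) s ≤
      Real.exp (m * ((twoGroupsPair p ψ).real {w | y < |w.2|} * (Real.exp s - 1))) := by
  have := isProbabilityMeasure_twoGroupsPair (ψ := ψ) hp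
  have hmeas : MeasurableSet {w : Bool × ℝ | y < |w.2|} :=
    measurable_snd (measurableSet_lt_abs y)
  set α := (twoGroupsPair p ψ).real {w | y < |w.2|} with hα
  set f : Bool × ℝ → ℝ := fun w => Real.exp (s * if y < |w.2| then (1 : ℝ) else 0) with hf
  have hfe : f = fun w => 1 + {w : Bool × ℝ | y < |w.2|}.indicator (fun _ => Real.exp s - 1) w := by
    funext w
    by_cases hw : y < |w.2| <;> simp [hf, hw]
  have hint : ∫ w, f w ∂(twoGroupsPair p ψ) = 1 + α * (Real.exp s - 1) := by
    rw [hfe, integral_add (integrable_const _) ((integrable_const _).indicator hmeas),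
      integral_indicator_const _ hmeas]
    simp [hα]
  have hmgf : mgf (fun ω => exceedances y (obs ω)) (twoGroups m p ψ) s =
      (1 + α * (Real.exp s - 1)) ^ m := by
    have h1 : ∀ ω : Fin m → Bool × ℝ, Real.exp (s * exceedances y (obs ω)) = ∏ j, f (ω j) := by
      intro ω
      rw [exceedances, Finset.mul_sum, Real.exp_sum]
      rfl
    rw [mgf]
    simp_rw [h1]
    rw [twoGroups, integral_fintype_prod_eq_pow, hint, Fintype.card_fin]
  have hα0 : 0 ≤ α := measureReal_nonneg
  have hα1 : α ≤ 1 := measureReal_le_one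
  rw [hmgf, Real.exp_nat_mul]
  refine pow_le_pow_left₀ ?_ (by linarith [Real.add_one_le_exp (α * (Real.exp s - 1))]) m
  nlinarith [Real.exp_pos s]

lemma exceedances_upper_tail (hp : 0 < p ∧ p < 1) (y k : ℝ) :
    (twoGroups m p ψ).real {ω | k ≤ exceedances y (obs ω)} ≤
      Real.exp (2 * (m * (twoGroupsPair p ψ).real {w | y < |w.2|}) - k) := by
  have := isProbabilityMeasure_twoGroups (m := m) (ψ := ψ) hp
  refine (measure_ge_le_exp_mul_mgf k zero_le_one (integrable_exp_exceedances hp 1 y)).trans ?_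
  refine (mul_le_mul_of_nonneg_left (mgf_exceedances_le hp 1 y) (Real.exp_pos _).le).trans ?_
  rw [← Real.exp_add, Real.exp_le_exp]
  have h1 : Real.exp 1 < 3 := by linarith [Real.exp_one_lt_d9]
  have h2 : 0 ≤ m * (twoGroupsPair p ψ).real {w | y < |w.2|} := by positivity
  nlinarith

lemma exceedances_lower_tail (hp : 0 < p ∧ p < 1) (y k : ℝ) :
    (twoGroups m p ψ).real {ω | exceedances y (obs ω) ≤ k} ≤
      Real.exp (k - m * (twoGroupsPair p ψ).real {w | y < |w.2|} / 2) := by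
  have := isProbabilityMeasure_twoGroups (m := m) (ψ := ψ) hp
  refine (measure_le_le_exp_mul_mgf k (t := -1) (by norm_num)
    (integrable_exp_exceedances hp (-1) y)).trans ?_
  refine (mul_le_mul_of_nonneg_left (mgf_exceedances_le hp (-1) y) (Real.exp_pos _).le).trans ?_
  rw [← Real.exp_add, Real.exp_le_exp]
  have h1 : Real.exp (-1) ≤ 1 / 2 := by
    rw [Real.exp_neg, ← one_div]
    exact one_div_le_one_div_of_le two_pos (by linarith [Real.exp_one_gt_d9])
  have h2 : 0 ≤ m * (twoGroupsPair p ψ).real {w | y < |w.2|} := by positivity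
  nlinarith

end Model

/-! ### Type I errors of the posterior rule under the null hypothesis -/

section NullRejection

variable {a K : ℝ} {L : ℝ → ℝ}

lemma mul_sqrt_neg_log_le {τ σ : ℝ} (hτ : 0 < τ) (hτσ : τ ≤ σ) (hσ : 1 ≤ -Real.log σ) :
    τ * √(-Real.log τ) ≤ σ * √(-Real.log σ) := by
  have hσ0 : 0 < σ := hτ.trans_le hτσ
  have hr1 : 1 ≤ σ / τ := (one_le_div₀ hτ).2 hτσ
  have hlog : -Real.log τ ≤ (σ / τ) ^ 2 * (-Real.log σ) := by
    have h1 := Real.log_le_sub_one_of_pos (x := σ / τ) (by positivity)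
    rw [Real.log_div hσ0.ne' hτ.ne'] at h1
    have h2 : 0 ≤ ((σ / τ) ^ 2 - 1) * (-Real.log σ - 1) :=
      mul_nonneg (by nlinarith) (by linarith)
    nlinarith
  calc τ * √(-Real.log τ) ≤ τ * √((σ / τ) ^ 2 * (-Real.log σ)) := by gcongr
    _ = σ * √(-Real.log σ) := by
        rw [Real.sqrt_mul (sq_nonneg _), Real.sqrt_sq (by positivity)]; field_simp

/-- Whatever the value of `τ ≤ σ`, rejection at `x` requires `|x|` to exceed a common threshold `y`,
and a standard normal variable does so with probability `o(σ)`. The factor `√(log(1/σ))` lost in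
the bound on `exp(-y² / 2)` is recovered from the factor `1 / y` in Mills' bound. -/
lemma IsLocalPrior.eventually_null_rejection (h : IsLocalPrior a K L)
    (ha : (1 / 2 < a ∧ a < 1) ∨
      (a = 1 / 2 ∧ Tendsto (fun t : ℝ => L t / √(Real.log t)) atTop (𝓝 0))) {δ : ℝ} (hδ : 0 < δ)
    (hδ1 : δ ≤ 1) :
    ∀ᶠ σ in 𝓝[>] 0, ∃ y, (∀ τ, 0 < τ → τ ≤ σ → ∀ x, 1 / 2 < 1 - postMeanShrink a K L x τ →
      y ≤ |x|) ∧ (gaussianReal 0 1).real {x | y ≤ |x|} ≤ δ * σ := by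
  obtain ⟨τ₀, hτ₀, hrej⟩ := mem_nhdsGT_iff_exists_Ioo_subset.1 (h.eventually_exp_le ha hδ)
  filter_upwards [Ioo_mem_nhdsGT hτ₀, tendsto_neg_log_nhdsGT_zero.eventually_ge_atTop 1]
    with σ hσ hlog
  have hσ0 : 0 < σ := hσ.1
  set g := δ * (σ * √(-Real.log σ)) with hg
  have hsq : 0 < √(-Real.log σ) := Real.sqrt_pos.2 (by linarith)
  have hg0 : 0 < g := by positivity
  have hg2 : g ^ 2 ≤ σ := by
    have h1 : -Real.log σ ≤ σ⁻¹ := by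
      have := Real.log_le_sub_one_of_pos (inv_pos.2 hσ0)
      rw [Real.log_inv] at this
      linarith
    calc g ^ 2 = δ ^ 2 * (σ ^ 2 * (-Real.log σ)) := by
          rw [hg, mul_pow, mul_pow, Real.sq_sqrt (by linarith)]
      _ ≤ 1 * (σ ^ 2 * σ⁻¹) := by
          have : δ ^ 2 ≤ 1 := pow_le_one₀ hδ.le hδ1
          gcongr
      _ = σ := by field_simp
  have hlogg : -Real.log σ ≤ -(2 * Real.log g) := by
    have := Real.log_le_log (by positivity) hg2
    rw [Real.log_pow] at this
    push_cast at this
    linarith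
  have hy2 : √(-(2 * Real.log g)) ^ 2 = -(2 * Real.log g) := Real.sq_sqrt (by linarith)
  refine ⟨√(-(2 * Real.log g)), fun τ hτ0 hτσ x hx => ?_, ?_⟩
  · have h1 : Real.exp (-(x ^ 2 / 2)) ≤ g := by
      refine (hrej (show τ ∈ Ioo 0 τ₀ from ⟨hτ0, hτσ.trans_lt hσ.2⟩) x hx).trans ?_
      exact mul_le_mul_of_nonneg_left (mul_sqrt_neg_log_le hτ0 hτσ hlog) hδ.le
    have h2 := (Real.le_log_iff_exp_le hg0).2 h1
    rw [← Real.sqrt_sq_eq_abs]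
    exact Real.sqrt_le_sqrt (by linarith)
  · have hy : √(-Real.log σ) ≤ √(-(2 * Real.log g)) := Real.sqrt_le_sqrt hlogg
    refine (gaussianReal_real_le_abs (hsq.trans_le hy)).trans ?_
    have e : Real.exp (-(√(-(2 * Real.log g)) ^ 2 / 2)) = g := by
      rw [hy2, show -(-(2 * Real.log g) / 2) = Real.log g by ring, Real.exp_log hg0]
    rw [e]
    calc g / √(-(2 * Real.log g)) ≤ g / √(-Real.log σ) := by gcongr
      _ = δ * σ := by rw [hg]; field_simp

end NullRejection

/-! ### Consequences of the asymptotic framework -/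

section Scheme

variable {p ψ : ℕ → ℝ} {C ε c : ℝ}

lemma AsympScheme.tendsto_neg_log_div (h : AsympScheme ψ p C) (hp : ∀ m, 0 < p m ∧ p m < 1)
    (hψ : ∀ m, 0 < ψ m) : Tendsto (fun m => -Real.log (p m) / ψ m ^ 2) atTop (𝓝 (C / 2)) := by
  have h1 : Tendsto (fun m => Real.log (ψ m ^ 2) / ψ m ^ 2) atTop (𝓝 0) :=
    Real.isLittleO_log_id_atTop.tendsto_div_nhds_zero.comp h.u_tendsto
  have h2 : Tendsto (fun m => Real.log (1 - p m) / ψ m ^ 2) atTop (𝓝 0) := by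
    refine Tendsto.div_atTop (a := 0) ?_ h.u_tendsto
    have h3 : Tendsto (fun m => 1 - p m) atTop (𝓝 1) := by
      simpa using h.p_tendsto.const_sub 1
    simpa [Function.comp_def] using (Real.continuousAt_log one_ne_zero).tendsto.comp h3
  have h4 := ((h.ratio_tendsto.sub h1).div_const 2).sub h2
  simp only [sub_zero] at h4
  refine h4.congr fun m => ?_
  have hu : 0 < ψ m ^ 2 := pow_pos (hψ m) 2
  have hq : 0 < 1 - p m := by linarith [(hp m).2]
  rw [Real.log_mul hu.ne' (pow_ne_zero 2 (div_pos hq (hp m).1).ne'),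
    Real.log_pow ((1 - p m) / p m) 2, Real.log_div hq.ne' (hp m).1.ne']
  push_cast
  ring

lemma AsympScheme.tendsto_log_div (h : AsympScheme ψ p C) (hp : ∀ m, 0 < p m ∧ p m < 1)
    (hψ : ∀ m, 0 < ψ m) (hε : 0 < ε) (hc : 0 < c)
    (hpε : ∀ᶠ m : ℕ in atTop, p m = c * (m : ℝ) ^ (-ε)) :
    Tendsto (fun m : ℕ => Real.log m / ψ m ^ 2) atTop (𝓝 (C / 2 / ε)) := by
  have h1 : Tendsto (fun m => Real.log c / ψ m ^ 2) atTop (𝓝 0) :=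
    tendsto_const_nhds.div_atTop h.u_tendsto
  have h2 := ((h.tendsto_neg_log_div hp hψ).add h1).div_const ε
  rw [add_zero] at h2
  refine h2.congr' ?_
  filter_upwards [hpε, eventually_gt_atTop 0] with m hm hm0
  have hm0' : (0 : ℝ) < m := by exact_mod_cast hm0
  rw [hm, Real.log_mul hc.ne' (Real.rpow_pos_of_pos hm0' _).ne', Real.log_rpow hm0']
  field_simp
  ring

lemma eventually_mul_eq (hpε : ∀ᶠ m : ℕ in atTop, p m = c * (m : ℝ) ^ (-ε)) :
    ∀ᶠ m : ℕ in atTop, m * p m = c * (m : ℝ) ^ (1 - ε) := by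
  filter_upwards [hpε, eventually_gt_atTop 0] with m hm hm0
  have hm0' : (0 : ℝ) < m := by exact_mod_cast hm0
  rw [hm, sub_eq_add_neg, Real.rpow_add hm0', Real.rpow_one]
  ring

lemma tendsto_rpow_natCast (hε1 : ε < 1) :
    Tendsto (fun m : ℕ => (m : ℝ) ^ (1 - ε)) atTop atTop :=
  (tendsto_rpow_atTop (by linarith)).comp tendsto_natCast_atTop_atTop

lemma tendsto_natCast_mul_atTop (hε1 : ε < 1) (hc : 0 < c)
    (hpε : ∀ᶠ m : ℕ in atTop, p m = c * (m : ℝ) ^ (-ε)) :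
    Tendsto (fun m : ℕ => m * p m) atTop atTop :=
  ((tendsto_rpow_natCast hε1).const_mul_atTop hc).congr' (by
    filter_upwards [eventually_mul_eq hpε] with m hm using hm.symm)

/-- Probabilities that are exponentially small in the expected number `m p` of signals are
negligible compared with `p`. -/
lemma tendsto_exp_neg_div (hε1 : ε < 1) (hc : 0 < c)
    (hpε : ∀ᶠ m : ℕ in atTop, p m = c * (m : ℝ) ^ (-ε)) {k : ℝ} (hk : 0 < k) :
    Tendsto (fun m : ℕ => Real.exp (-(k * (m * p m))) / p m) atTop (𝓝 0) := by
  have h1 := ((tendsto_rpow_mul_exp_neg_mul_atTop_nhds_zero (ε / (1 - ε)) (k * c)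
    (by positivity)).comp (tendsto_rpow_natCast hε1)).div_const c
  rw [zero_div] at h1
  refine h1.congr' ?_
  filter_upwards [hpε, eventually_mul_eq hpε, eventually_gt_atTop 0] with m hm hm' hm0
  have hm0' : (0 : ℝ) < m := by exact_mod_cast hm0
  have e : ((m : ℝ) ^ (1 - ε)) ^ (ε / (1 - ε)) = (m : ℝ) ^ ε := by
    rw [← Real.rpow_mul hm0'.le, mul_div_cancel₀ _ (by linarith)]
  simp only [Function.comp_apply]
  rw [hm', hm, e, Real.rpow_neg hm0'.le, ← mul_assoc, neg_mul]
  field_simp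

/-- The probability of an exceedance is of exact order `p`: under the null hypothesis it is at most
`1 / m`, and under the alternative it stays away from `0`. -/
lemma AsympScheme.exists_exceedance_bounds (h : AsympScheme ψ p C) (hp : ∀ m, 0 < p m ∧ p m < 1)
    (hψ : ∀ m, 0 < ψ m) (hε : 0 < ε) (hε1 : ε < 1) (hc : 0 < c)
    (hpε : ∀ᶠ m : ℕ in atTop, p m = c * (m : ℝ) ^ (-ε)) {c₁ : ℝ} (hc₁ : 2 ≤ c₁) :
    ∃ β, 0 < β ∧ ∀ᶠ m : ℕ in atTop,
      β * p m ≤ (twoGroupsPair (p m) (ψ m)).real {w | √(c₁ * Real.log m) < |w.2|} ∧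
        (twoGroupsPair (p m) (ψ m)).real {w | √(c₁ * Real.log m) < |w.2|} ≤ 2 * p m := by
  set M := c₁ * (C / 2 / ε + 1) with hM
  have hC := h.C_pos
  have hM0 : 0 < M := by positivity
  have hopen : IsOpen {z : ℝ | M < z ^ 2} := isOpen_lt (by fun_prop) (by fun_prop)
  refine ⟨(gaussianReal 0 1).real {z | M < z ^ 2},
    gaussianReal_real_pos_of_isOpen hopen ⟨√(M + 1), by
      change M < √(M + 1) ^ 2
      rw [Real.sq_sqrt (by linarith)]; linarith⟩, ?_⟩
  filter_upwards [(h.tendsto_log_div hp hψ hε hc hpε).eventually_lt_const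
    (lt_add_one (C / 2 / ε)), (tendsto_natCast_mul_atTop hε1 hc hpε).eventually_ge_atTop 1,
    (Real.tendsto_log_atTop.comp tendsto_natCast_atTop_atTop).eventually_ge_atTop 1,
    eventually_gt_atTop 0] with m hlogm hmp hlog1 hm0
  have hm0' : (0 : ℝ) < m := by exact_mod_cast hm0
  simp only [Function.comp_apply] at hlog1
  have hu : 0 < ψ m ^ 2 := pow_pos (hψ m) 2
  set y := √(c₁ * Real.log m) with hy
  have hy2 : y ^ 2 = c₁ * Real.log m := Real.sq_sqrt (by positivity)
  have hset := twoGroupsPair_real_snd (ψ := ψ m) (hp m) (measurableSet_lt_abs y)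
  change (twoGroupsPair (p m) (ψ m)).real {w | y < |w.2|} = _ at hset
  rw [hset]
  constructor
  · have h1 : (gaussianReal 0 1).real {z | M < z ^ 2} ≤
        (gaussianReal 0 (Real.toNNReal (1 + ψ m ^ 2))).real {x | y < |x|} := by
      rw [gaussianReal_real_scale (by positivity) (measurableSet_lt_abs y)]
      refine measureReal_mono fun z (hz : M < z ^ 2) => ?_
      change y < |√(1 + ψ m ^ 2) * z|
      refine lt_of_pow_lt_pow_left₀ 2 (abs_nonneg _) ?_
      rw [sq_abs, mul_pow, Real.sq_sqrt (show 0 ≤ 1 + ψ m ^ 2 by positivity), hy2]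
      rw [div_lt_iff₀ hu] at hlogm
      calc c₁ * Real.log m ≤ c₁ * ((C / 2 / ε + 1) * ψ m ^ 2) := by gcongr
        _ = ψ m ^ 2 * M := by rw [hM]; ring
        _ < (1 + ψ m ^ 2) * z ^ 2 := by nlinarith
    have h2 : 0 ≤ (1 - p m) * (gaussianReal 0 1).real {x | y < |x|} :=
      mul_nonneg (by linarith [(hp m).2]) measureReal_nonneg
    have h3 := mul_le_mul_of_nonneg_left h1 (hp m).1.le
    linarith
  · have hy1 : 1 ≤ y := Real.one_le_sqrt.2 (by nlinarith)
    have h1 : (gaussianReal 0 1).real {x | y < |x|} ≤ p m := by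
      calc (gaussianReal 0 1).real {x | y < |x|} ≤ (gaussianReal 0 1).real {x | y ≤ |x|} :=
          measureReal_mono fun x (hx : y < |x|) => hx.le
        _ ≤ Real.exp (-(y ^ 2 / 2)) / y := gaussianReal_real_le_abs (by linarith)
        _ ≤ Real.exp (-(y ^ 2 / 2)) := div_le_self (Real.exp_pos _).le hy1
        _ ≤ Real.exp (-Real.log m) := Real.exp_le_exp.2 (by rw [hy2]; nlinarith)
        _ = 1 / m := by rw [Real.exp_neg, Real.exp_log hm0', one_div]
        _ ≤ p m := by rw [div_le_iff₀ hm0']; linarith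
    have h2 : (gaussianReal 0 (Real.toNNReal (1 + ψ m ^ 2))).real {x | y < |x|} ≤ 1 :=
      measureReal_le_one
    have h3 : (1 - p m) * (gaussianReal 0 1).real {x | y < |x|} ≤ 1 * p m :=
      mul_le_mul (by linarith [(hp m).1]) h1 measureReal_nonneg zero_le_one
    have h4 := mul_le_mul_of_nonneg_left h2 (hp m).1.le
    linarith

lemma tauHat_eq (c₁ c₂ : ℝ) {m : ℕ} (x : Fin m → ℝ) :
    tauHat c₁ c₂ x = max (1 / (m : ℝ)) (1 / (c₂ * m) * exceedances √(c₁ * Real.log m) x) := rfl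

/-- The estimate `τ̂` is of exact order `p`, up to an event of probability `o(p)`. -/
lemma AsympScheme.exists_tauHat_bounds (h : AsympScheme ψ p C) (hp : ∀ m, 0 < p m ∧ p m < 1)
    (hψ : ∀ m, 0 < ψ m) (hε : 0 < ε) (hε1 : ε < 1) (hc : 0 < c)
    (hpε : ∀ᶠ m : ℕ in atTop, p m = c * (m : ℝ) ^ (-ε)) {c₁ c₂ : ℝ} (hc₁ : 2 ≤ c₁)
    (hc₂ : 1 ≤ c₂) :
    ∃ b, 0 < b ∧ ∀ e, 0 < e → ∀ᶠ m : ℕ in atTop,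
      (twoGroups m (p m) (ψ m)).real
        {ω | tauHat c₁ c₂ (obs ω) < b * p m ∨ 5 * p m < tauHat c₁ c₂ (obs ω)} ≤ e * p m := by
  obtain ⟨β, hβ, hα⟩ := h.exists_exceedance_bounds hp hψ hε hε1 hc hpε hc₁
  refine ⟨β / (4 * c₂), by positivity, fun e he => ?_⟩
  filter_upwards [hα, (tendsto_natCast_mul_atTop hε1 hc hpε).eventually_ge_atTop 1,
    (tendsto_exp_neg_div hε1 hc hpε one_pos).eventually_lt_const (half_pos he),
    (tendsto_exp_neg_div hε1 hc hpε (k := β / 4) (by positivity)).eventually_lt_const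
      (half_pos he), eventually_gt_atTop 0] with m ⟨hα1, hα2⟩ hmp he1 he2 hm0
  have hm0' : (0 : ℝ) < m := by exact_mod_cast hm0
  have hp0 := (hp m).1
  have := isProbabilityMeasure_twoGroups (m := m) (ψ := ψ m) (hp m)
  rw [div_lt_iff₀ hp0] at he1 he2
  set y := √(c₁ * Real.log m) with hy
  set α := (twoGroupsPair (p m) (ψ m)).real {w | y < |w.2|} with hαd
  have hsub : {ω : Fin m → Bool × ℝ | tauHat c₁ c₂ (obs ω) < β / (4 * c₂) * p m ∨
      5 * p m < tauHat c₁ c₂ (obs ω)} ⊆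
      {ω | exceedances y (obs ω) ≤ β / 4 * (m * p m)} ∪
        {ω | 5 * (m * p m) ≤ exceedances y (obs ω)} := by
    rintro ω (hω | hω)
    · left
      rw [tauHat_eq, max_lt_iff, ← hy] at hω
      have hω2 := hω.2
      rw [div_mul_eq_mul_div, one_mul, div_lt_iff₀ (by positivity)] at hω2
      have e1 : β / (4 * c₂) * p m * (c₂ * m) = β / 4 * (m * p m) := by field_simp
      change exceedances y (obs ω) ≤ _
      linarith
    · right
      rw [tauHat_eq, lt_max_iff, ← hy] at hω
      change _ ≤ exceedances y (obs ω)
      rcases hω with hω | hω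
      · rw [lt_div_iff₀ hm0'] at hω
        linarith
      · rw [div_mul_eq_mul_div, one_mul, lt_div_iff₀ (by positivity)] at hω
        have : 5 * p m * (1 * m) ≤ 5 * p m * (c₂ * m) := by gcongr
        linarith
  refine (measureReal_mono hsub).trans ((measureReal_union_le _ _).trans ?_)
  have h1 := exceedances_lower_tail (m := m) (ψ := ψ m) (hp m) y (β / 4 * (m * p m))
  have h2 := exceedances_upper_tail (m := m) (ψ := ψ m) (hp m) y (5 * (m * p m))
  rw [← hαd] at h1 h2
  have h3 : Real.exp (β / 4 * (m * p m) - m * α / 2) ≤ Real.exp (-(β / 4 * (m * p m))) := by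
    refine Real.exp_le_exp.2 ?_
    have := mul_le_mul_of_nonneg_left hα1 hm0'.le
    linarith
  have h4 : Real.exp (2 * (m * α) - 5 * (m * p m)) ≤ Real.exp (-(1 * (m * p m))) := by
    refine Real.exp_le_exp.2 ?_
    have := mul_le_mul_of_nonneg_left hα2 hm0'.le
    linarith
  linarith

/-! ### Risk bounds -/

/-- The risk of the Bayes Oracle is at least of order `m p`. -/
lemma AsympScheme.eventually_le_bayesRisk_bayesOracle (h : AsympScheme ψ p C)
    (hp : ∀ m, 0 < p m ∧ p m < 1) (hψ : ∀ m, 0 < ψ m) :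
    ∀ᶠ m : ℕ in atTop, m * p m * (gaussianReal 0 1).real {z | z ^ 2 ≤ C / 2} ≤
      bayesRisk (p m) (ψ m) (bayesOracle m (p m) (ψ m)) := by
  filter_upwards [h.ratio_tendsto.eventually_const_lt (u := C / 2) (half_lt_self h.C_pos)] with m hv
  have hu : 0 < ψ m ^ 2 := pow_pos (hψ m) 2
  have hw : 0 < 1 + ψ m ^ 2 := by positivity
  have hq : 0 < (1 - p m) / p m := div_pos (by linarith [(hp m).2]) (hp m).1
  have hS : MeasurableSet {x : ℝ | x ^ 2 ≤ (1 + ψ m ^ 2) * (C / 2)} :=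
    measurableSet_le (by fun_prop) (by fun_prop)
  have hscale : (gaussianReal 0 1).real {z | z ^ 2 ≤ C / 2} =
      (gaussianReal 0 (Real.toNNReal (1 + ψ m ^ 2))).real
        {x | x ^ 2 ≤ (1 + ψ m ^ 2) * (C / 2)} := by
    rw [gaussianReal_real_scale hw.le hS]
    congr 1
    ext z
    change z ^ 2 ≤ C / 2 ↔ (√(1 + ψ m ^ 2) * z) ^ 2 ≤ _
    rw [mul_pow, Real.sq_sqrt hw.le, mul_le_mul_iff_right₀ hw]
  rw [hscale]
  refine le_bayesRisk (hp m) _ hS fun x i (hx : x i ^ 2 ≤ _) => ?_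
  refine fun (hreject : (1 - p m) / p m < _ / _) => hreject.not_ge ?_
  have hpdf : gaussianPDFReal 0 (Real.toNNReal (1 + ψ m ^ 2)) (x i) / gaussianPDFReal 0 1 (x i) =
      (√(1 + ψ m ^ 2))⁻¹ * Real.exp (ψ m ^ 2 / (1 + ψ m ^ 2) * x i ^ 2 / 2) := by
    have e : Real.exp (-x i ^ 2 / (2 * (1 + ψ m ^ 2))) =
        Real.exp (ψ m ^ 2 / (1 + ψ m ^ 2) * x i ^ 2 / 2) * Real.exp (-x i ^ 2 / 2) := by
      rw [← Real.exp_add]; congr 1; field_simp; ring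
    have h2 : √(2 * Real.pi) ≠ 0 := (Real.sqrt_pos.2 (by positivity)).ne'
    have h3 : √(1 + ψ m ^ 2) ≠ 0 := (Real.sqrt_pos.2 hw).ne'
    simp only [gaussianPDFReal, Real.coe_toNNReal _ hw.le, sub_zero, NNReal.coe_one, mul_one, e]
    rw [Real.sqrt_mul (by positivity) (1 + ψ m ^ 2)]
    field_simp
  rw [hpdf]
  refine le_of_sq_le_sq ?_ hq.le
  rw [lt_div_iff₀ hu] at hv
  have hv' := (Real.lt_log_iff_exp_lt (by positivity)).1 hv
  have hexp : Real.exp (ψ m ^ 2 / (1 + ψ m ^ 2) * x i ^ 2 / 2) ^ 2 ≤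
      Real.exp (C / 2 * ψ m ^ 2) := by
    rw [← Real.exp_nat_mul]
    refine Real.exp_le_exp.2 ?_
    calc _ = ψ m ^ 2 / (1 + ψ m ^ 2) * x i ^ 2 := by push_cast; ring
      _ ≤ ψ m ^ 2 / (1 + ψ m ^ 2) * ((1 + ψ m ^ 2) * (C / 2)) := by gcongr
      _ = _ := by field_simp
  rw [mul_pow, inv_pow, Real.sq_sqrt hw.le]
  calc _ ≤ (1 + ψ m ^ 2)⁻¹ * (ψ m ^ 2 * ((1 - p m) / p m) ^ 2) := by
        gcongr; exact hexp.trans hv'.le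
    _ = ψ m ^ 2 / (1 + ψ m ^ 2) * ((1 - p m) / p m) ^ 2 := by ring
    _ ≤ 1 * ((1 - p m) / p m) ^ 2 := by
        gcongr; rw [div_le_one hw]; linarith
    _ = _ := one_mul _

/-- The risk of the empirical Bayes rule is asymptotically at most `m p` times the probability of
`z² ≤ r` for a standard normal `z`, for any `r > 4aC`. -/
lemma AsympScheme.eventually_bayesRisk_ebRule_le (h : AsympScheme ψ p C)
    (hp : ∀ m, 0 < p m ∧ p m < 1) (hψ : ∀ m, 0 < ψ m) (hε : 0 < ε) (hε1 : ε < 1) (hc : 0 < c)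
    (hpε : ∀ᶠ m : ℕ in atTop, p m = c * (m : ℝ) ^ (-ε)) {c₁ c₂ : ℝ} (hc₁ : 2 ≤ c₁)
    (hc₂ : 1 ≤ c₂) {a K : ℝ} {L : ℝ → ℝ} (hprior : IsLocalPrior a K L)
    (ha : (1 / 2 < a ∧ a < 1) ∨
      (a = 1 / 2 ∧ Tendsto (fun t : ℝ => L t / √(Real.log t)) atTop (𝓝 0)))
    {r : ℝ} (hr : 4 * a * C < r) {e : ℝ} (he : 0 < e) :
    ∀ᶠ m : ℕ in atTop, bayesRisk (p m) (ψ m) (ebRule a K L c₁ c₂ m) ≤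
      m * p m * ((gaussianReal 0 1).real {z | z ^ 2 ≤ r} + e) := by
  have hC := h.C_pos
  have ha0 : 0 < a := by rcases ha with ⟨h1, -⟩ | ⟨h1, -⟩ <;> linarith
  -- `Q > 8a` makes `x² ≥ Q log(1/τ)` sufficient for rejection, and `Q C / 2 < r` puts the
  -- resulting threshold for `z²` below `r`.
  obtain ⟨Q, hQ1, hQ2⟩ : ∃ Q, 8 * a < Q ∧ Q < 2 * r / C :=
    exists_between (by rw [lt_div_iff₀ hC]; linarith)
  have hQ0 : 0 < Q := by linarith
  obtain ⟨b, hb, hbad⟩ := h.exists_tauHat_bounds hp hψ hε hε1 hc hpε hc₁ hc₂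
  obtain ⟨δ, hδ0, hδ⟩ : ∃ δ, 0 < δ ∧ δ ≤ 1 ∧ 5 * δ ≤ e / 2 :=
    ⟨min 1 (e / 10), by positivity, min_le_left _ _, by linarith [min_le_right 1 (e / 10)]⟩
  have h5p : Tendsto (fun m => 5 * p m) atTop (𝓝[>] 0) := by
    refine tendsto_nhdsWithin_iff.2 ⟨by simpa using h.p_tendsto.const_mul 5,
      .of_forall fun m => ?_⟩
    have := (hp m).1
    simp only [mem_Ioi]; positivity
  obtain ⟨τ₀, hτ₀, hrej⟩ := mem_nhdsGT_iff_exists_Ioo_subset.1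
    (hprior.eventually_reject ha0 hQ1)
  have hthr : Tendsto (fun m => Q * (-Real.log (p m) / ψ m ^ 2 + -Real.log b / ψ m ^ 2)) atTop
      (𝓝 (Q * (C / 2 + 0))) :=
    ((h.tendsto_neg_log_div hp hψ).add (tendsto_const_nhds.div_atTop h.u_tendsto)).const_mul Q
  have hQr : Q * (C / 2 + 0) < r := by rw [lt_div_iff₀ hC] at hQ2; linarith
  filter_upwards [hbad (e / 4) (by positivity),
    h5p.eventually (hprior.eventually_null_rejection ha hδ0 hδ.1),
    h5p.eventually (Ioo_mem_nhdsGT hτ₀), hthr.eventually_lt_const hQr, eventually_gt_atTop 0]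
    with m hB ⟨y, hy, hyδ⟩ hsmall hlog hm0
  have hm0' : (0 : ℝ) < m := by exact_mod_cast hm0
  have hp0 := (hp m).1
  have hu : 0 < ψ m ^ 2 := pow_pos (hψ m) 2
  have hS : MeasurableSet {x : ℝ | y ≤ |x|} := measurableSet_le measurable_const measurable_norm
  have hS' : MeasurableSet {x : ℝ | x ^ 2 ≤ (1 + ψ m ^ 2) * r} :=
    measurableSet_le (by fun_prop) (by fun_prop)
  have hτpos : ∀ x : Fin m → ℝ, 0 < tauHat c₁ c₂ x := fun x =>
    (one_div_pos.2 hm0').trans_le (le_max_left _ _)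
  have hrisk := bayesRisk_le (ψ := ψ m) (hp m) (ebRule a K L c₁ c₂ m) hS hS'
    {ω | tauHat c₁ c₂ (obs ω) < b * p m ∨ 5 * p m < tauHat c₁ c₂ (obs ω)}
    (fun ω hω i hi => ?_) (fun ω hω i hi => ?_)
  · have hscale : (gaussianReal 0 (Real.toNNReal (1 + ψ m ^ 2))).real
        {x | x ^ 2 ≤ (1 + ψ m ^ 2) * r} = (gaussianReal 0 1).real {z | z ^ 2 ≤ r} := by
      have hw : 0 < 1 + ψ m ^ 2 := by positivity
      rw [gaussianReal_real_scale hw.le hS']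
      congr 1
      ext z
      change (√(1 + ψ m ^ 2) * z) ^ 2 ≤ _ ↔ z ^ 2 ≤ r
      rw [mul_pow, Real.sq_sqrt hw.le, mul_le_mul_iff_right₀ hw]
    rw [hscale] at hrisk
    refine hrisk.trans ?_
    rw [mul_assoc (m : ℝ)]
    refine mul_le_mul_of_nonneg_left ?_ hm0'.le
    have h1 : δ * (5 * p m) ≤ e / 2 * p m := by
      calc δ * (5 * p m) = 5 * δ * p m := by ring
        _ ≤ _ := by gcongr; exact hδ.2
    linarith
  · have hω' : ¬ (_ ∨ _) := hω
    push Not at hω'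
    exact hy _ (hτpos _) hω'.2 _ hi
  · have hω' : ¬ (_ ∨ _) := hω
    push Not at hω'
    by_contra hcon
    refine hi (hrej (show tauHat c₁ c₂ (obs ω) ∈ Ioo 0 τ₀ from
      ⟨hτpos _, hω'.2.trans_lt hsmall.2⟩) _ ?_)
    have hcon' : ¬ ((ω i).2 ^ 2 ≤ (1 + ψ m ^ 2) * r) := hcon
    have hl : Real.log (p m) + Real.log b ≤ Real.log (tauHat c₁ c₂ (obs ω)) := by
      rw [add_comm, ← Real.log_mul hb.ne' hp0.ne']
      exact Real.log_le_log (by positivity) hω'.1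
    have hl2 : Q * (-Real.log (p m) + -Real.log b) < r * ψ m ^ 2 := by
      rwa [← add_div, ← mul_div_assoc, div_lt_iff₀ hu] at hlog
    have hr0 : 0 < r := lt_trans (by positivity) hr
    have hl3 : Q * (-Real.log (tauHat c₁ c₂ (obs ω))) ≤
        Q * (-Real.log (p m) + -Real.log b) := by gcongr; linarith
    change _ ≤ (ω i).2 ^ 2
    nlinarith

end Scheme

end MultTest

theorem theorem3p2
    (p ψ : ℕ → ℝ) (C ε c₁ c₂ a K : ℝ) (L : ℝ → ℝ)
    (hp : ∀ m, 0 < p m ∧ p m < 1) (hψ : ∀ m, 0 < ψ m)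
    (hscheme : MultTest.AsympScheme ψ p C)
    (hε : 0 < ε ∧ ε < 1)
    (hpε : ∃ c : ℝ, 0 < c ∧ ∀ᶠ m : ℕ in Filter.atTop, p m = c * (m : ℝ) ^ (-ε))
    (hc₁ : 2 ≤ c₁) (hc₂ : 1 ≤ c₂)
    (hprior : MultTest.IsLocalPrior a K L)
    (ha : (1 / 2 < a ∧ a < 1) ∨
      (a = 1 / 2 ∧
        Filter.Tendsto (fun t : ℝ => L t / √(Real.log t)) Filter.atTop (nhds 0))) :
    (∀ η δ : ℝ, 0 < η → η < 1 / 2 → 0 < δ → δ < 1 →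
      ∃ r : ℕ → ℝ, Filter.Tendsto r Filter.atTop (nhds 0) ∧
        ∀ᶠ m : ℕ in Filter.atTop,
          MultTest.bayesRisk (p m) (ψ m) (MultTest.ebRule a K L c₁ c₂ m) ≤
            m * p m * (2 * MultTest.stdNormalCDF √(2 * a * C / (η * (1 - δ))) - 1) *
              (1 + r m)) ∧
    (fun m : ℕ => MultTest.bayesRisk (p m) (ψ m) (MultTest.ebRule a K L c₁ c₂ m))
      =O[Filter.atTop]
    (fun m : ℕ => MultTest.bayesRisk (p m) (ψ m) (MultTest.bayesOracle m (p m) (ψ m))) := by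
  obtain ⟨c, hc, hpε⟩ := hpε
  have hC := hscheme.C_pos
  have ha0 : 0 < a := by rcases ha with ⟨h1, -⟩ | ⟨h1, -⟩ <;> linarith
  have hrisk {r e : ℝ} (hr : 4 * a * C < r) (he : 0 < e) :=
    hscheme.eventually_bayesRisk_ebRule_le hp hψ hε.1 hε.2 hc hpε hc₁ hc₂ hprior ha hr he
  have hmp : ∀ᶠ m : ℕ in atTop, 0 < m * p m := by
    filter_upwards [eventually_gt_atTop 0] with m hm
    exact mul_pos (by exact_mod_cast hm) (hp m).1
  refine ⟨fun η δ hη0 hη hδ0 hδ => ?_, ?_⟩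
  · have hθ : 0 < η * (1 - δ) := mul_pos hη0 (by linarith)
    have hr : 4 * a * C < 2 * a * C / (η * (1 - δ)) := by
      have hθ2 : η * (1 - δ) < 1 / 2 := by nlinarith
      rw [lt_div_iff₀ hθ]
      have : 0 < 2 * a * C := by positivity
      nlinarith
    set r₀ := 2 * a * C / (η * (1 - δ)) with hr₀
    have hr₀0 : 0 < r₀ := lt_trans (by positivity) hr
    rw [← MultTest.gaussianReal_real_sq_le hr₀0.le]
    set β := (gaussianReal 0 1).real {z | z ^ 2 ≤ r₀} with hβ
    have hβ0 : 0 < β := MultTest.gaussianReal_real_sq_le_pos hr₀0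
    -- The relative excess of the risk over the bound serves as the `o(1)` term.
    refine ⟨fun m => max 0 (MultTest.bayesRisk (p m) (ψ m) (MultTest.ebRule a K L c₁ c₂ m) /
      (m * p m * β) - 1), ?_, ?_⟩
    · refine tendsto_order.2 ⟨fun x hx => .of_forall fun m => hx.trans_le (le_max_left _ _),
        fun x hx => ?_⟩
      filter_upwards [hrisk hr (e := x / 2 * β) (by positivity), hmp] with m hm hmp
      refine max_lt hx ?_
      rw [sub_lt_iff_lt_add, div_lt_iff₀ (by positivity)]
      calc _ ≤ m * p m * (β + x / 2 * β) := hm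
        _ < (x + 1) * (m * p m * β) := by nlinarith [mul_pos (mul_pos hmp hβ0) hx]
    · filter_upwards [hmp] with m hmp
      have hpos : 0 < m * p m * β := by positivity
      rw [← div_le_iff₀' hpos]
      linarith [le_max_right 0 (MultTest.bayesRisk (p m) (ψ m)
        (MultTest.ebRule a K L c₁ c₂ m) / (m * p m * β) - 1)]
  · have hβ0 := MultTest.gaussianReal_real_sq_le_pos (half_pos hC)
    set β := (gaussianReal 0 1).real {z | z ^ 2 ≤ C / 2} with hβ
    refine Asymptotics.IsBigO.of_bound (2 / β) ?_
    filter_upwards [hrisk (lt_add_one (4 * a * C)) one_pos,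
      hscheme.eventually_le_bayesRisk_bayesOracle hp hψ, hmp] with m hEB hBO hmp
    have hnn : 0 ≤ MultTest.bayesRisk (p m) (ψ m) (MultTest.ebRule a K L c₁ c₂ m) :=
      Finset.sum_nonneg fun i _ => add_nonneg
        (mul_nonneg (by linarith [(hp m).2]) measureReal_nonneg)
        (mul_nonneg (hp m).1.le measureReal_nonneg)
    have hBO0 : 0 < m * p m * β := by positivity
    rw [Real.norm_of_nonneg hnn, Real.norm_of_nonneg (hBO0.le.trans hBO)]
    have h1 : (gaussianReal 0 1).real {z | z ^ 2 ≤ 4 * a * C + 1} ≤ 1 := measureReal_le_one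
    calc _ ≤ m * p m * ((gaussianReal 0 1).real {z | z ^ 2 ≤ 4 * a * C + 1} + 1) := hEB
      _ ≤ m * p m * 2 := by gcongr; linarith
      _ = 2 / β * (m * p m * β) := by field_simp
      _ ≤ _ := by gcongr
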